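/- Let $n,T\in\mathbb N$, $N=\{1,\dots,n\}$, and let $\mathcal G$ be the set of weighted undirected networks, i.e. symmetric real $n\times n$ matrices $\mathbf G=(g_{ij})$ with $g_{ij}\in[0,1]$ and $g_{ii}=0$. A network is unweighted if all $g_{ij}\in\{0,1\}$. Let $S_w$ be the set of paths $(\mathbf G(t))_{t=1}^T$ in $\mathcal G$ such that, with $\mathbf G(0)=\mathbf 0$, for every $t=1,\dots,T$ one has $\mathbf G(t)=\mathbf G(t-1)+\mathbf W$ for some symmetric entrywise nonnegative $\mathbf W$ with $\mathbf 1'\mathbf W\mathbf 1=2$ (one unit of weight is added in each period). Let $S\subset S_w$ be the set of unweighted paths, on which exactly one new link between two distinct unlinked nodes is added in each period. Let $\phi>0$ satisfy $\phi<1/\lambda_{\max}(\mathbf G(t))$ for every path in $S_w$ and every $t\in\{1,\dots,T\}$, where $\lambda_{\max}$ is the spectral radius. Let $b(\mathbf G)=\sum_{i\in N} b_i(\mathbf G)$ be aggregate Katz–Bonacich centrality, where $b_i(\mathbf G)=\lim_{L\to\infty}\sum_{k=0}^{L}\phi^k\,(\mathbf 1'\mathbf G^k)_i$. Let $D(t)\in[0,1]$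 for $t=1,\dots,T$, and let $v(\mathbf s)=\sum_{t=1}^T D(t)\,b(\mathbf G(t))$ for a path $\mathbf s=(\mathbf G(t))_{t=1}^T$. Let $\mathbf s^*=(\mathbf G^*(t))_{t=1}^T\in S_w$ maximize $v$ over $S_w$. Then: 1. For every $t\in\{1,\dots,T\}$ with $D(t)>0$, $\mathbf G^*(t)$ is an unweighted nested split graph (NSG): it is unweighted and, writing $N_i=\{j:g^*_{ij}(t)=1\}$, for all $i\ne j$ either $N_i\setminus\{j\}\subseteq N_j\setminus\{i\}$ or $N_j\setminus\{i\}\subseteq N_i\setminus\{j\}$. 2. Suppose the planner is myopic: for all $\mathbf s=(\mathbf G(t))_{t=1}^T$ and $\hat{\mathbf s}=(\hat{\mathbf G}(t))_{t=1}^T$ in $S$, if $t'$ is the first period with $b(\mathbf G(t'))\ne b(\hat{\mathbf G}(t'))$ and $b(\mathbf G(t'))>b(\hat{\mathbf G}(t'))$, then $v(\mathbf s)>v(\hat{\mathbf s})$. Then for every $t\in\{1,\dots,T\}$ with $D(t)>0$ (in particular for every $t$ if $D$ is positive), $\mathbf G^*(t)$ is an unweighted quasi-complete graph: an NSG with $t$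 links that contains a complete subgraph on $p$ nodes, where $\frac{p(p-1)}2\le t<\frac{p(p+1)}2$, and whose remaining $t-\frac{p(p-1)}2$ links (if any) all join one single further node to nodes of that complete subgraph. -/

import Mathlib

open scoped Matrix
open Filter

namespace NetworkDesign

/-- Feasible weighted undirected networks on `n` nodes: symmetric matrices with entries in `[0,1]`
and zero diagonal. -/
def networks (n : ℕ) : Set (Matrix (Fin n) (Fin n) ℝ) :=
  {G | (∀ i j, G i j = G j i) ∧ (∀ i j, 0 ≤ G i j ∧ G i j ≤ 1) ∧ ∀ i, G i i = 0}

/-- The weighted networks succeeding `G`: one unit of (undirected) weight is added, which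
increases the sum of all entries by `2`. -/
def weightedSucc {n : ℕ} (G : Matrix (Fin n) (Fin n) ℝ) : Set (Matrix (Fin n) (Fin n) ℝ) :=
  {G' | G' ∈ networks n ∧ ∃ W : Matrix (Fin n) (Fin n) ℝ,
    (∀ i j, 0 ≤ W i j) ∧ W = Wᵀ ∧ (1 : Fin n → ℝ) ⬝ᵥ (W *ᵥ 1) = 2 ∧ G' = G + W}

/-- The matrix `E i j` with `1` in the entries `(i, j)` and `(j, i)` (for `i ≠ j`). -/
def linkMatrix {n : ℕ} (i j : Fin n) : Matrix (Fin n) (Fin n) ℝ :=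
  Matrix.single i j 1 + Matrix.single j i 1

/-- The unweighted networks succeeding `G`: a link is added between two unlinked nodes. -/
def linkSucc {n : ℕ} (G : Matrix (Fin n) (Fin n) ℝ) : Set (Matrix (Fin n) (Fin n) ℝ) :=
  {G' | ∃ i j : Fin n, i ≠ j ∧ G i j = 0 ∧ G' = G + linkMatrix i j}

/-- Feasible weighted formation paths `G(1), …, G(T)` starting from the empty network `G(0) = 0`.
Only the values at `0, …, T` of the sequence matter. -/
def weightedPaths (n T : ℕ) : Set (ℕ → Matrix (Fin n) (Fin n) ℝ) :=
  {s | s 0 = 0 ∧ ∀ t < T, s (t + 1) ∈ weightedSucc (s t)}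

/-- Feasible unweighted formation paths: one new link per period, starting from the empty
network. -/
def linkPaths (n T : ℕ) : Set (ℕ → Matrix (Fin n) (Fin n) ℝ) :=
  {s | s 0 = 0 ∧ ∀ t < T, s (t + 1) ∈ linkSucc (s t)}

/-- Diffusion centrality of node `i`: the sum over `k = 0, …, L` of `φ ^ k` times the `i`-th entry
of the row vector `1ᵀ G ^ k`. -/
noncomputable def diffusion {n : ℕ} (φ : ℝ) (L : ℕ) (G : Matrix (Fin n) (Fin n) ℝ) (i : Fin n) :
    ℝ :=
  ∑ k ∈ Finset.range (L + 1), φ ^ k * ((1 : Fin n → ℝ) ᵥ* G ^ k) i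

/-- Katz–Bonacich centrality of node `i`: the limit of diffusion centrality as `L → ∞`. The limit
exists when `φ` is less than the inverse of the spectral radius of `G`. -/
noncomputable def katzBonacich {n : ℕ} (φ : ℝ) (G : Matrix (Fin n) (Fin n) ℝ) (i : Fin n) : ℝ :=
  limUnder atTop (fun L : ℕ => diffusion φ L G i)

/-- Aggregate Katz–Bonacich centrality. -/
noncomputable def aggregateKB {n : ℕ} (φ : ℝ) (G : Matrix (Fin n) (Fin n) ℝ) : ℝ :=
  ∑ i, katzBonacich φ G i

/-- The discounted sum of aggregate Katz–Bonacich centralities along a path. -/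
noncomputable def payoff {n : ℕ} (φ : ℝ) (T : ℕ) (D : ℕ → ℝ)
    (s : ℕ → Matrix (Fin n) (Fin n) ℝ) : ℝ :=
  ∑ t ∈ Finset.Icc 1 T, D t * aggregateKB φ (s t)

/-- `s` solves the weighted design problem. -/
def IsSolution {n : ℕ} (φ : ℝ) (T : ℕ) (D : ℕ → ℝ) (s : ℕ → Matrix (Fin n) (Fin n) ℝ) : Prop :=
  s ∈ weightedPaths n T ∧ ∀ s' ∈ weightedPaths n T, payoff φ T D s' ≤ payoff φ T D s

/-- The planner is myopic: between two sequences of succeeding (unweighted) networks, the one with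
the larger instantaneous utility at the first period at which the utilities differ has the larger
payoff. -/
def IsMyopic (n : ℕ) (φ : ℝ) (T : ℕ) (D : ℕ → ℝ) : Prop :=
  ∀ s ∈ linkPaths n T, ∀ s' ∈ linkPaths n T, ∀ t ∈ Finset.Icc 1 T,
    (∀ r ∈ Finset.Icc 1 T, r < t → aggregateKB φ (s r) = aggregateKB φ (s' r)) →
    aggregateKB φ (s' t) < aggregateKB φ (s t) → payoff φ T D s' < payoff φ T D s

/-- Unweighted networks: all entries of the adjacency matrix are `0` or `1`. -/
def IsUnweighted {n : ℕ} (G : Matrix (Fin n) (Fin n) ℝ) : Prop :=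
  G ∈ networks n ∧ ∀ i j, G i j = 0 ∨ G i j = 1

/-- The neighbours of node `i`. -/
def neighbours {n : ℕ} (G : Matrix (Fin n) (Fin n) ℝ) (i : Fin n) : Set (Fin n) :=
  {j | G i j = 1}

/-- (Unweighted) nested split graphs. -/
def IsNSG {n : ℕ} (G : Matrix (Fin n) (Fin n) ℝ) : Prop :=
  IsUnweighted G ∧ ∀ i j, i ≠ j →
    neighbours G i \ {j} ⊆ neighbours G j \ {i} ∨ neighbours G j \ {i} ⊆ neighbours G i \ {j}

/-- The number of links of an unweighted network. -/
noncomputable def numLinks {n : ℕ} (G : Matrix (Fin n) (Fin n) ℝ) : ℕ :=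
  Set.ncard {e : Fin n × Fin n | e.1 < e.2 ∧ G e.1 e.2 = 1}

/-- Quasi-complete graphs with `t` links: nested split graphs with `t` links that contain a complete
subgraph on a set `P` of `p` nodes, where `p (p - 1) / 2 ≤ t < p (p + 1) / 2`, and whose remaining
links (if any) all join one further node `q` to nodes of `P`. -/
def IsQuasiComplete {n : ℕ} (t : ℕ) (G : Matrix (Fin n) (Fin n) ℝ) : Prop :=
  IsNSG G ∧ numLinks G = t ∧ ∃ P : Finset (Fin n),
    P.card * (P.card - 1) / 2 ≤ t ∧ t < P.card * (P.card + 1) / 2 ∧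
    (∀ i ∈ P, ∀ j ∈ P, i ≠ j → G i j = 1) ∧
    ((∀ i j, G i j = 1 → i ∈ P ∧ j ∈ P) ∨
      ∃ q, q ∉ P ∧ ∀ i j, G i j = 1 →
        (i ∈ P ∧ j ∈ P) ∨ (i ∈ P ∧ j = q) ∨ (i = q ∧ j ∈ P))

end NetworkDesign

/-! Write `A = 1 - φG`, which is positive definite. The centrality vector solves `A x = 1`, and
completing the square shows that it is the unique maximizer of `2 ∑ yᵢ - yᵀ A y`, with maximum
`b(G)` (`aggregateKB_sub_eq`). As a maximum of functions affine in `G`, `b` is convex, and equality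
in Jensen's inequality forces equal centrality vectors (`aggregateKB_sum_le`).

By Birkhoff's theorem a weighted path is a mixture of unweighted ones, so every component of
positive weight in an optimal path is itself optimal. Compressing a whole path, which moves
neighbours from `j` to `i` in all periods at once, preserves feasibility and never lowers `b`. It
raises `b` strictly where neighbourhoods are not nested, so optimal unweighted paths are nested
wherever `D > 0`. A nested split graph is determined by its centrality vector; hence the components
coincide there, and the mixture is itself unweighted and nested (`exists_linkPaths_solution`).

Under myopia the unweighted optimal path is greedy in every period. Its networks are quasi-complete
by induction: any link that breaks the form is beaten by another one. Three strict comparisons show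
this, all derived from the resolvent identity `aggregateKB_sub_aggregateKB`. -/

namespace NetworkDesign

variable {n T : ℕ} {φ : ℝ} {D : ℕ → ℝ} {G H : Matrix (Fin n) (Fin n) ℝ}
  {s : ℕ → Matrix (Fin n) (Fin n) ℝ}

/-! ### Centrality as the solution of a positive definite system -/

/-- Networks on which Katz–Bonacich centrality with parameter `φ` is well behaved. -/
structure IsAdmissible (φ : ℝ) (G : Matrix (Fin n) (Fin n) ℝ) : Prop where
  pos : 0 < φ
  symm : ∀ i j, G i j = G j i
  nonneg : ∀ i j, 0 ≤ G i j
  posDef : (1 - φ • G).PosDef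

/-- An eigenvalue `μ` of `1 - φG` yields the eigenvalue `(1 - μ)/φ` of `G`. Its modulus is at most
the spectral radius, hence `1 - μ < 1`. -/
theorem isAdmissible_of_spectralRadius (hφ : 0 < φ) (hG : G ∈ networks n)
    (h : ENNReal.ofReal φ < 1 / spectralRadius ℝ G) : IsAdmissible φ G := by
  obtain ⟨h1, h2, h3⟩ := hG
  refine ⟨hφ, h1, fun i j => (h2 i j).1, ?_⟩
  have hA : (1 - φ • G).IsHermitian := by
    ext i j
    simp [Matrix.conjTranspose_apply, Matrix.one_apply, h1 i j, eq_comm]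
  rw [hA.posDef_iff_eigenvalues_pos]
  intro a
  set μ := hA.eigenvalues a with hμ
  have hmem : μ ∈ spectrum ℝ (1 - φ • G) := hA.eigenvalues_mem_spectrum_real a
  have hmem2 : (1 - μ) / φ ∈ spectrum ℝ G := by
    rw [spectrum.mem_iff] at hmem ⊢
    intro hu
    apply hmem
    have : algebraMap ℝ (Matrix (Fin n) (Fin n) ℝ) μ - (1 - φ • G)
        = (Units.mk0 (-φ) (neg_ne_zero.2 hφ.ne')) •
          (algebraMap ℝ (Matrix (Fin n) (Fin n) ℝ) ((1 - μ) / φ) - G) := by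
      ext i j
      simp only [Units.smul_mk0, Matrix.smul_apply, Matrix.sub_apply, Matrix.algebraMap_matrix_apply,
        Matrix.one_apply, smul_eq_mul, Algebra.algebraMap_self, RingHom.id_apply]
      split_ifs <;> field_simp <;> ring
    rw [this]
    exact (IsUnit.smul _ hu)
  have hle : (‖(1 - μ) / φ‖₊ : ENNReal) ≤ spectralRadius ℝ G :=
    le_iSup₂ (f := fun k (_ : k ∈ spectrum ℝ G) => (‖k‖₊ : ENNReal)) _ hmem2
  have h4 : ENNReal.ofReal φ * (‖(1 - μ) / φ‖₊ : ENNReal) < 1 := by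
    by_cases h0 : (‖(1 - μ) / φ‖₊ : ENNReal) = 0
    · rw [h0, mul_zero]; exact one_pos
    have : ENNReal.ofReal φ < 1 / (‖(1 - μ) / φ‖₊ : ENNReal) :=
      h.trans_le (ENNReal.div_le_div_left hle 1)
    rwa [ENNReal.lt_div_iff_mul_lt (Or.inl h0) (Or.inl ENNReal.coe_ne_top)] at this
  have h5 : φ * |(1 - μ) / φ| < 1 := by
    rwa [← enorm_eq_nnnorm, ← ofReal_norm, ← ENNReal.ofReal_mul hφ.le,
      ENNReal.ofReal_lt_one, Real.norm_eq_abs] at h4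
  have h6 : φ * ((1 - μ) / φ) < 1 := lt_of_le_of_lt (by gcongr; exact le_abs_self _) h5
  rw [mul_div_cancel₀ _ hφ.ne'] at h6
  linarith

theorem mulVec_apply_eq_sum (G : Matrix (Fin n) (Fin n) ℝ) (x : Fin n → ℝ) (i : Fin n) :
    (G *ᵥ x) i = ∑ j, G i j * x j := rfl

theorem mulVec_nonneg (hG : ∀ i j, 0 ≤ G i j) {x : Fin n → ℝ} (hx : ∀ j, 0 ≤ x j) (i : Fin n) :
    0 ≤ (G *ᵥ x) i := by
  rw [mulVec_apply_eq_sum]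
  exact Finset.sum_nonneg fun j _ => mul_nonneg (hG i j) (hx j)

theorem isAdmissible_zero (hφ : 0 < φ) : IsAdmissible φ (0 : Matrix (Fin n) (Fin n) ℝ) :=
  ⟨hφ, by simp, by simp, by simpa using Matrix.PosDef.one⟩

namespace IsAdmissible

theorem transpose_eq (hG : IsAdmissible φ G) : (1 - φ • G)ᵀ = 1 - φ • G := by
  ext i j; simp [Matrix.one_apply, hG.symm i j, eq_comm]

theorem dotProduct_comm (hG : IsAdmissible φ G) (x y : Fin n → ℝ) :
    x ⬝ᵥ ((1 - φ • G) *ᵥ y) = y ⬝ᵥ ((1 - φ • G) *ᵥ x) := by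
  rw [Matrix.dotProduct_mulVec, ← Matrix.mulVec_transpose, hG.transpose_eq, _root_.dotProduct_comm]

theorem quad_nonneg (hG : IsAdmissible φ G) (x : Fin n → ℝ) :
    0 ≤ x ⬝ᵥ ((1 - φ • G) *ᵥ x) := by
  simpa using hG.posDef.posSemidef.dotProduct_mulVec_nonneg x

theorem quad_pos (hG : IsAdmissible φ G) {x : Fin n → ℝ} (hx : x ≠ 0) :
    0 < x ⬝ᵥ ((1 - φ • G) *ᵥ x) := by
  simpa using hG.posDef.dotProduct_mulVec_pos hx

theorem diffusion_succ (hG : IsAdmissible φ G) (L : ℕ) (i : Fin n) :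
    diffusion φ (L + 1) G i = 1 + φ * (G *ᵥ diffusion φ L G) i := by
  have hT : Gᵀ = G := by ext i j; exact hG.symm j i
  have hP : ∀ k, ((1 : Fin n → ℝ) ᵥ* G ^ (k + 1)) = G *ᵥ ((1 : Fin n → ℝ) ᵥ* G ^ k) := by
    intro k
    rw [pow_succ, ← Matrix.vecMul_vecMul, ← Matrix.mulVec_transpose G, hT]
  unfold diffusion
  rw [Finset.sum_range_succ', add_comm]
  congr 1
  · simp
  · simp only [hP, Matrix.mulVec, dotProduct, Finset.mul_sum]
    rw [Finset.sum_comm]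
    refine Finset.sum_congr rfl fun j _ => Finset.sum_congr rfl fun k _ => ?_
    ring

theorem diffusion_nonneg (hG : IsAdmissible φ G) (L : ℕ) (i : Fin n) : 0 ≤ diffusion φ L G i := by
  induction L generalizing i with
  | zero => simp [diffusion]
  | succ L ih =>
    rw [hG.diffusion_succ]
    have : 0 ≤ (G *ᵥ diffusion φ L G) i := mulVec_nonneg hG.nonneg ih i
    have := hG.pos
    positivity

theorem diffusion_mono (hG : IsAdmissible φ G) (i : Fin n) :
    Monotone fun L => diffusion φ L G i := by
  refine monotone_nat_of_le_succ fun L => ?_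
  induction L generalizing i with
  | zero =>
    rw [hG.diffusion_succ]
    have : 0 ≤ (G *ᵥ diffusion φ 0 G) i :=
      mulVec_nonneg hG.nonneg (hG.diffusion_nonneg 0) i
    have := mul_nonneg hG.pos.le this
    simpa [diffusion] using this
  | succ L ih =>
    rw [hG.diffusion_succ (L + 1), hG.diffusion_succ L]
    have : (G *ᵥ diffusion φ L G) i ≤ (G *ᵥ diffusion φ (L + 1) G) i := by
      rw [mulVec_apply_eq_sum, mulVec_apply_eq_sum]
      exact Finset.sum_le_sum fun j _ => mul_le_mul_of_nonneg_left (ih j) (hG.nonneg i j)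
    have := mul_le_mul_of_nonneg_left this hG.pos.le
    linarith

theorem mulVec_apply (x : Fin n → ℝ) (i : Fin n) :
    ((1 - φ • G) *ᵥ x) i = x i - φ * (G *ᵥ x) i := by
  simp [Matrix.sub_mulVec, Matrix.smul_mulVec]

theorem exists_solution (hG : IsAdmissible φ G) :
    ∃ z : Fin n → ℝ, (1 - φ • G) *ᵥ z = 1 := by
  refine ⟨(1 - φ • G)⁻¹ *ᵥ 1, ?_⟩
  rw [Matrix.mulVec_mulVec, Matrix.mul_nonsing_inv _ hG.posDef.det_pos.ne'.isUnit,
    Matrix.one_mulVec]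

/-- This bound gives convergence without any norm estimate. Monotonicity in `L` turns the recursion
into `A x ≤ 1` for the partial sum `x`, so `xᵀ A x ≤ ∑ xᵢ`; expanding `(x - z)ᵀ A (x - z) ≥ 0` then
gives the claim. -/
theorem sum_diffusion_le (hG : IsAdmissible φ G) {z : Fin n → ℝ} (hz : (1 - φ • G) *ᵥ z = 1)
    (L : ℕ) : ∑ i, diffusion φ L G i ≤ ∑ i, z i := by
  set x := diffusion φ L G with hx
  have h1 : x ⬝ᵥ ((1 - φ • G) *ᵥ x) ≤ ∑ i, x i := by
    refine Finset.sum_le_sum fun i _ => ?_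
    have hle : ((1 - φ • G) *ᵥ x) i ≤ 1 := by
      have := hG.diffusion_mono i (Nat.le_succ L)
      simp only [hG.diffusion_succ] at this
      rw [mulVec_apply]
      linarith
    simpa using mul_le_mul_of_nonneg_left hle (hG.diffusion_nonneg L i)
  have h2 := hG.quad_nonneg (x - z)
  have h3 := hG.dotProduct_comm x z
  rw [Matrix.mulVec_sub, dotProduct_sub, sub_dotProduct, sub_dotProduct, ← h3, hz] at h2
  have e1 : x ⬝ᵥ (1 : Fin n → ℝ) = ∑ i, x i := by simp [dotProduct]
  have e2 : z ⬝ᵥ (1 : Fin n → ℝ) = ∑ i, z i := by simp [dotProduct]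
  rw [hz] at *
  linarith

theorem tendsto_diffusion (hG : IsAdmissible φ G) (i : Fin n) :
    Tendsto (fun L => diffusion φ L G i) atTop (nhds (katzBonacich φ G i)) := by
  obtain ⟨z, hz⟩ := hG.exists_solution
  have hb : BddAbove (Set.range fun L => diffusion φ L G i) := by
    refine ⟨∑ j, z j, ?_⟩
    rintro _ ⟨L, rfl⟩
    exact (Finset.single_le_sum (fun j _ => hG.diffusion_nonneg L j) (Finset.mem_univ i)).trans
      (hG.sum_diffusion_le hz L)
  exact tendsto_nhds_limUnder ⟨_, tendsto_atTop_ciSup (hG.diffusion_mono i) hb⟩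

theorem katzBonacich_eq (hG : IsAdmissible φ G) (i : Fin n) :
    katzBonacich φ G i = 1 + φ * (G *ᵥ katzBonacich φ G) i := by
  have h1 := (tendsto_add_atTop_iff_nat 1).2 (hG.tendsto_diffusion i)
  simp only [hG.diffusion_succ] at h1
  refine tendsto_nhds_unique h1 (Tendsto.const_add _ (Tendsto.const_mul _ ?_))
  simp only [mulVec_apply_eq_sum]
  exact tendsto_finsetSum _ fun j _ => (hG.tendsto_diffusion j).const_mul _

theorem mulVec_katzBonacich (hG : IsAdmissible φ G) :
    (1 - φ • G) *ᵥ katzBonacich φ G = 1 := by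
  ext i
  rw [mulVec_apply, Pi.one_apply]
  linarith [hG.katzBonacich_eq i]

theorem one_le_katzBonacich (hG : IsAdmissible φ G) (i : Fin n) : 1 ≤ katzBonacich φ G i := by
  refine ge_of_tendsto (hG.tendsto_diffusion i) (Eventually.of_forall fun L => ?_)
  calc (1 : ℝ) = diffusion φ 0 G i := by simp [diffusion]
    _ ≤ _ := hG.diffusion_mono i (Nat.zero_le L)

theorem katzBonacich_pos (hG : IsAdmissible φ G) (i : Fin n) : 0 < katzBonacich φ G i :=
  one_pos.trans_le (hG.one_le_katzBonacich i)

/-- Completing the square. Nonnegativity of the right side gives the variational lower bound, and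
definiteness gives uniqueness of the maximizer. -/
theorem aggregateKB_sub_eq (hG : IsAdmissible φ G) (y : Fin n → ℝ) :
    aggregateKB φ G - (2 * ∑ i, y i - y ⬝ᵥ ((1 - φ • G) *ᵥ y)) =
      (y - katzBonacich φ G) ⬝ᵥ ((1 - φ • G) *ᵥ (y - katzBonacich φ G)) := by
  have h3 := hG.dotProduct_comm y (katzBonacich φ G)
  rw [Matrix.mulVec_sub, dotProduct_sub, sub_dotProduct, sub_dotProduct, ← h3,
    hG.mulVec_katzBonacich]
  have e1 : y ⬝ᵥ (1 : Fin n → ℝ) = ∑ i, y i := by simp [dotProduct]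
  have e2 : katzBonacich φ G ⬝ᵥ (1 : Fin n → ℝ) = aggregateKB φ G := by
    simp [dotProduct, aggregateKB]
  rw [e1, e2]
  ring

theorem le_aggregateKB (hG : IsAdmissible φ G) (y : Fin n → ℝ) :
    2 * ∑ i, y i - y ⬝ᵥ ((1 - φ • G) *ᵥ y) ≤ aggregateKB φ G := by
  have := hG.aggregateKB_sub_eq y
  have := hG.quad_nonneg (y - katzBonacich φ G)
  linarith

theorem eq_katzBonacich (hG : IsAdmissible φ G) {y : Fin n → ℝ}
    (h : aggregateKB φ G ≤ 2 * ∑ i, y i - y ⬝ᵥ ((1 - φ • G) *ᵥ y)) : y = katzBonacich φ G := by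
  by_contra hne
  have := hG.aggregateKB_sub_eq y
  have := hG.quad_pos (sub_ne_zero.2 hne)
  linarith

theorem aggregateKB_eq (hG : IsAdmissible φ G) :
    aggregateKB φ G = 2 * ∑ i, katzBonacich φ G i -
      katzBonacich φ G ⬝ᵥ ((1 - φ • G) *ᵥ katzBonacich φ G) := by
  have := hG.aggregateKB_sub_eq (katzBonacich φ G)
  simp only [sub_self, zero_dotProduct] at this
  linarith

/-- The resolvent identity, obtained by testing each system against the other's solution. It is
exact, so finite changes of the network can be compared. -/
theorem aggregateKB_sub_aggregateKB (hG : IsAdmissible φ G) (hH : IsAdmissible φ H) :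
    aggregateKB φ H - aggregateKB φ G =
      φ * (katzBonacich φ G ⬝ᵥ ((H - G) *ᵥ katzBonacich φ H)) := by
  have h1 : katzBonacich φ H ⬝ᵥ ((1 - φ • G) *ᵥ katzBonacich φ G) = aggregateKB φ H := by
    rw [hG.mulVec_katzBonacich]; simp [dotProduct, aggregateKB]
  have h2 : katzBonacich φ G ⬝ᵥ ((1 - φ • H) *ᵥ katzBonacich φ H) = aggregateKB φ G := by
    rw [hH.mulVec_katzBonacich]; simp [dotProduct, aggregateKB]
  rw [hG.dotProduct_comm] at h1
  rw [← h1, ← h2, ← dotProduct_sub, ← Matrix.sub_mulVec, ← smul_eq_mul, ← dotProduct_smul,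
    ← Matrix.smul_mulVec]
  congr 2
  rw [smul_sub]
  abel

end IsAdmissible

/-- Jensen's inequality for aggregate centrality. -/
theorem aggregateKB_sum_le {ι : Type*} [Fintype ι] {w : ι → ℝ} (hw : ∀ a, 0 ≤ w a)
    (hw1 : ∑ a, w a = 1) {F : ι → Matrix (Fin n) (Fin n) ℝ} (hG : IsAdmissible φ G)
    (hF : ∀ a, IsAdmissible φ (F a)) (h : G = ∑ a, w a • F a) :
    aggregateKB φ G ≤ ∑ a, w a * aggregateKB φ (F a) ∧
      (∑ a, w a * aggregateKB φ (F a) ≤ aggregateKB φ G →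
        ∀ a, 0 < w a → katzBonacich φ (F a) = katzBonacich φ G) := by
  set x := katzBonacich φ G with hx
  -- For a fixed trial vector the functional is affine in the network, and `x` attains the maximum
  -- for `G`.
  have key : aggregateKB φ G = ∑ a, w a * (2 * ∑ i, x i - x ⬝ᵥ ((1 - φ • F a) *ᵥ x)) := by
    rw [hG.aggregateKB_eq, ← hx]
    have : (1 - φ • G) = ∑ a, w a • (1 - φ • F a) := by
      simp only [smul_sub, Finset.sum_sub_distrib, ← Finset.sum_smul, hw1, one_smul]
      rw [h, Finset.smul_sum]
      simp only [smul_comm φ]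
    rw [this, Matrix.sum_mulVec, dotProduct_sum]
    simp only [Matrix.smul_mulVec, dotProduct_smul, smul_eq_mul, mul_sub,
      Finset.sum_sub_distrib, ← Finset.sum_mul, hw1, one_mul]
  have hle : ∀ a ∈ Finset.univ, w a * (2 * ∑ i, x i - x ⬝ᵥ ((1 - φ • F a) *ᵥ x)) ≤
      w a * aggregateKB φ (F a) := fun a _ =>
    mul_le_mul_of_nonneg_left ((hF a).le_aggregateKB x) (hw a)
  refine ⟨key ▸ Finset.sum_le_sum hle, fun hge a ha => ?_⟩
  rw [key] at hge
  have := (Finset.sum_eq_sum_iff_of_le hle).1 (le_antisymm (Finset.sum_le_sum hle) hge) a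
    (Finset.mem_univ a)
  exact ((hF a).eq_katzBonacich (mul_left_cancel₀ ha.ne' this).ge).symm

/-- Aggregate centrality does not depend on the labelling of the nodes. -/
theorem aggregateKB_submatrix (e : Equiv.Perm (Fin n)) (hG : IsAdmissible φ G)
    (hH : IsAdmissible φ (G.submatrix e e)) :
    aggregateKB φ (G.submatrix e e) = aggregateKB φ G := by
  -- The relabelled vector solves the relabelled system, whose solution is unique.
  have h0 : (1 - φ • G.submatrix e e) *ᵥ (katzBonacich φ G ∘ e) = 1 := by
    ext i
    rw [IsAdmissible.mulVec_apply, Matrix.submatrix_mulVec_equiv]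
    have := hG.katzBonacich_eq (e i)
    simp only [Function.comp_assoc, Equiv.self_comp_symm, Function.comp_id, Function.comp_apply,
      Pi.one_apply]
    linarith
  have h1 : katzBonacich φ G ∘ e = katzBonacich φ (G.submatrix e e) := by
    by_contra hne
    have := hH.quad_pos (sub_ne_zero.2 hne)
    rw [Matrix.mulVec_sub, h0, hH.mulVec_katzBonacich, sub_self, dotProduct_zero] at this
    exact this.false
  rw [aggregateKB, ← h1]
  exact Equiv.sum_comp e _

/-! ### Weighted and unweighted paths -/

theorem total_eq_sum (G : Matrix (Fin n) (Fin n) ℝ) :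
    (1 : Fin n → ℝ) ⬝ᵥ (G *ᵥ 1) = ∑ i, ∑ j, G i j := by
  simp [dotProduct, mulVec_apply_eq_sum]

theorem zero_mem_networks : (0 : Matrix (Fin n) (Fin n) ℝ) ∈ networks n := by
  simp [networks]

theorem mem_weightedSucc_iff (hG : G ∈ networks n) :
    H ∈ weightedSucc G ↔ H ∈ networks n ∧ (∀ i j, G i j ≤ H i j) ∧
      ∑ i, ∑ j, H i j = ∑ i, ∑ j, G i j + 2 := by
  constructor
  · rintro ⟨h1, W, h2, h3, h4, rfl⟩
    refine ⟨h1, fun i j => by simpa using h2 i j, ?_⟩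
    rw [total_eq_sum] at h4
    simp [Finset.sum_add_distrib, h4]
  · rintro ⟨h1, h2, h3⟩
    refine ⟨h1, H - G, fun i j => by simpa using h2 i j, ?_, ?_, by abel⟩
    · ext i j
      simp [h1.1 i j, hG.1 i j]
    · rw [total_eq_sum]
      simp only [Matrix.sub_apply, Finset.sum_sub_distrib, h3]
      ring

theorem networks_of_mem_weightedPaths (hs : s ∈ weightedPaths n T) {t : ℕ} (ht : t ≤ T) :
    s t ∈ networks n := by
  cases t with
  | zero => rw [hs.1]; exact zero_mem_networks
  | succ t => exact (hs.2 t ht).1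

theorem mem_weightedPaths_iff :
    s ∈ weightedPaths n T ↔ s 0 = 0 ∧ ∀ t < T, s (t + 1) ∈ networks n ∧
      (∀ i j, s t i j ≤ s (t + 1) i j) ∧
      ∑ i, ∑ j, s (t + 1) i j = ∑ i, ∑ j, s t i j + 2 := by
  constructor
  · intro hs
    exact ⟨hs.1, fun t ht =>
      (mem_weightedSucc_iff (networks_of_mem_weightedPaths hs ht.le)).1 (hs.2 t ht)⟩
  · rintro ⟨h0, h⟩
    refine ⟨h0, fun t ht => (mem_weightedSucc_iff ?_).2 (h t ht)⟩
    cases t with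
    | zero => rw [h0]; exact zero_mem_networks
    | succ t => exact (h t (Nat.lt_of_succ_lt ht)).1

theorem total_of_mem_weightedPaths (hs : s ∈ weightedPaths n T) {t : ℕ} (ht : t ≤ T) :
    ∑ i, ∑ j, s t i j = 2 * t := by
  induction t with
  | zero => simp [hs.1]
  | succ t ih =>
    rw [((mem_weightedPaths_iff.1 hs).2 t ht).2.2, ih (Nat.le_of_succ_le ht)]
    push_cast; ring

theorem linkMatrix_apply {i j : Fin n} (hij : i ≠ j) (a b : Fin n) :
    linkMatrix i j a b = if (a = i ∧ b = j) ∨ (a = j ∧ b = i) then 1 else 0 := by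
  simp only [linkMatrix, Matrix.add_apply, Matrix.single_apply]
  split_ifs <;> grind

theorem linkMatrix_comm (i j : Fin n) : linkMatrix i j = linkMatrix j i := add_comm _ _

theorem total_linkMatrix (i j : Fin n) : ∑ a, ∑ b, linkMatrix i j a b = 2 := by
  simp only [linkMatrix, Matrix.add_apply, Matrix.single_apply, Finset.sum_add_distrib, ite_and]
  simp
  norm_num

theorem linkMatrix_mulVec (i j : Fin n) (x : Fin n → ℝ) :
    linkMatrix i j *ᵥ x = Pi.single i (x j) + Pi.single j (x i) := by
  simp [linkMatrix, Matrix.add_mulVec, Matrix.single_mulVec, Pi.single]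

theorem IsUnweighted.add_linkMatrix (hG : IsUnweighted G) {i j : Fin n} (hij : i ≠ j)
    (h0 : G i j = 0) : IsUnweighted (G + linkMatrix i j) := by
  have h0' : G j i = 0 := by rw [hG.1.1 j i, h0]
  have key : ∀ a b, (G + linkMatrix i j) a b = 0 ∨ (G + linkMatrix i j) a b = 1 := by
    intro a b
    rw [Matrix.add_apply, linkMatrix_apply hij]
    split_ifs with h
    · rcases h with ⟨rfl, rfl⟩ | ⟨rfl, rfl⟩ <;> simp [h0, h0']
    · simpa using hG.2 a b
  refine ⟨⟨fun a b => ?_, fun a b => ?_, fun a => ?_⟩, key⟩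
  · rw [Matrix.add_apply, Matrix.add_apply, linkMatrix_apply hij, linkMatrix_apply hij, hG.1.1 a b]
    congr 1
    grind
  · rcases key a b with h | h <;> rw [h] <;> norm_num
  · rw [Matrix.add_apply, linkMatrix_apply hij, hG.1.2.2 a]
    grind

theorem IsUnweighted.of_mem_linkSucc (hG : IsUnweighted G) (hH : H ∈ linkSucc G) :
    IsUnweighted H := by
  obtain ⟨i, j, hij, h0, rfl⟩ := hH
  exact hG.add_linkMatrix hij h0

theorem isUnweighted_zero : IsUnweighted (0 : Matrix (Fin n) (Fin n) ℝ) :=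
  ⟨zero_mem_networks, by simp⟩

theorem isUnweighted_of_mem_linkPaths (hs : s ∈ linkPaths n T) {t : ℕ} (ht : t ≤ T) :
    IsUnweighted (s t) := by
  induction t with
  | zero => rw [hs.1]; exact isUnweighted_zero
  | succ t ih => exact (ih (Nat.le_of_succ_le ht)).of_mem_linkSucc (hs.2 t ht)

theorem linkPaths_subset_weightedPaths : linkPaths n T ⊆ weightedPaths n T := by
  intro s hs
  rw [mem_weightedPaths_iff]
  refine ⟨hs.1, fun t ht => ⟨(isUnweighted_of_mem_linkPaths hs ht).1, ?_, ?_⟩⟩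
  · obtain ⟨i, j, hij, -, h⟩ := hs.2 t ht
    intro a b
    rw [h, Matrix.add_apply, linkMatrix_apply hij]
    split_ifs <;> simp
  · obtain ⟨i, j, hij, -, h⟩ := hs.2 t ht
    rw [h]
    simp only [Matrix.add_apply, Finset.sum_add_distrib, total_linkMatrix]

/-! ### Compression -/

/-- The weight by which node `j` is more strongly tied than `i` to each third node. -/
def excess (G : Matrix (Fin n) (Fin n) ℝ) (i j : Fin n) (b : Fin n) : ℝ :=
  if b = i ∨ b = j then 0 else max (G i b) (G j b) - G i b

/-- The compression moving the excess weight of node `j` to node `i`. -/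
def compress (G : Matrix (Fin n) (Fin n) ℝ) (i j : Fin n) : Matrix (Fin n) (Fin n) ℝ :=
  G + (Matrix.vecMulVec (Pi.single i 1 - Pi.single j 1) (excess G i j) +
    Matrix.vecMulVec (excess G i j) (Pi.single i 1 - Pi.single j 1))

theorem excess_nonneg (i j b : Fin n) : 0 ≤ excess G i j b := by
  unfold excess
  split_ifs
  exacts [le_rfl, sub_nonneg.2 (le_max_left _ _)]

/-- The rank-two form suits quadratic forms; this max/min form makes symmetry, bounds and
monotonicity visible. -/
theorem compress_apply (hG : ∀ a b, G a b = G b a) {i j : Fin n} (hij : i ≠ j) (a b : Fin n) :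
    compress G i j a b =
      if a = i ∧ b ≠ i ∧ b ≠ j then max (G i b) (G j b)
      else if a = j ∧ b ≠ i ∧ b ≠ j then min (G i b) (G j b)
      else if b = i ∧ a ≠ i ∧ a ≠ j then max (G a i) (G a j)
      else if b = j ∧ a ≠ i ∧ a ≠ j then min (G a i) (G a j)
      else G a b := by
  have hmin : ∀ x y : ℝ, y + (x - max x y) = min x y := fun x y => by
    linarith [min_add_max x y]
  simp only [compress, Matrix.add_apply, Matrix.vecMulVec_apply, Pi.sub_apply, Pi.single_apply,
    excess]
  by_cases hai : a = i <;> by_cases haj : a = j <;> by_cases hbi : b = i <;>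
    by_cases hbj : b = j <;> simp [hai, haj, hbi, hbj, hij, hij.symm, hG a, hmin]

theorem compress_mem_networks (hG : G ∈ networks n) {i j : Fin n} (hij : i ≠ j) :
    compress G i j ∈ networks n := by
  obtain ⟨h1, h2, h3⟩ := hG
  refine ⟨fun a b => ?_, fun a b => ?_, fun a => ?_⟩
  · have := h1 a b
    have := h1 a i
    have := h1 a j
    have := h1 b i
    have := h1 b j
    rw [compress_apply h1 hij, compress_apply h1 hij]
    split_ifs <;> grind
  · have := h2 a b
    have := h2 a i
    have := h2 a j
    have := h2 i b
    have := h2 j b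
    rw [compress_apply h1 hij]
    split_ifs <;> grind
  · have := h3 a
    rw [compress_apply h1 hij]
    split_ifs <;> grind

/-- Maxima and minima are monotone, so compressing every period of a path keeps its increments
nonnegative. -/
theorem compress_mono (hG : ∀ a b, G a b = G b a) (hH : ∀ a b, H a b = H b a)
    (hGH : ∀ a b, G a b ≤ H a b) {i j : Fin n} (hij : i ≠ j) (a b : Fin n) :
    compress G i j a b ≤ compress H i j a b := by
  rw [compress_apply hG hij, compress_apply hH hij]
  split_ifs
  · exact max_le_max (hGH i b) (hGH j b)
  · exact min_le_min (hGH i b) (hGH j b)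
  · exact max_le_max (hGH a i) (hGH a j)
  · exact min_le_min (hGH a i) (hGH a j)
  · exact hGH a b

theorem total_compress (i j : Fin n) :
    ∑ a, ∑ b, compress G i j a b = ∑ a, ∑ b, G a b := by
  simp only [compress, Matrix.add_apply, Finset.sum_add_distrib, Matrix.vecMulVec_apply,
    ← Finset.mul_sum, ← Finset.sum_mul, Pi.sub_apply, Finset.sum_sub_distrib]
  simp

theorem compress_zero (i j : Fin n) : compress (0 : Matrix (Fin n) (Fin n) ℝ) i j = 0 := by
  have : excess (0 : Matrix (Fin n) (Fin n) ℝ) i j = 0 := by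
    ext b; simp [excess]
  simp [compress, this]

theorem compress_mem_weightedPaths (hs : s ∈ weightedPaths n T) {i j : Fin n} (hij : i ≠ j) :
    (fun t => compress (s t) i j) ∈ weightedPaths n T := by
  have hs' := mem_weightedPaths_iff.1 hs
  refine mem_weightedPaths_iff.2 ⟨?_, fun t ht => ⟨?_, ?_, ?_⟩⟩
  · simp only [hs.1, compress_zero]
  · exact compress_mem_networks (hs'.2 t ht).1 hij
  · exact compress_mono (networks_of_mem_weightedPaths hs ht.le).1 (hs'.2 t ht).1.1
      (hs'.2 t ht).2.1 hij
  · simp only [total_compress, (hs'.2 t ht).2.2]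

/-- Compressing towards `i` or towards `j` gives isomorphic networks, so either node may be taken as
the more central one, even if their order varies over time. -/
theorem compress_swap (hG : G ∈ networks n) {i j : Fin n} (hij : i ≠ j) :
    (compress G i j).submatrix (Equiv.swap i j) (Equiv.swap i j) = compress G j i := by
  ext a b
  rw [Matrix.submatrix_apply, compress_apply hG.1 hij, compress_apply hG.1 hij.symm]
  simp only [Equiv.swap_apply_def]
  by_cases hai : a = i <;> by_cases haj : a = j <;> by_cases hbi : b = i <;>
    by_cases hbj : b = j <;>
    simp [hai, haj, hbi, hbj, hij, hij.symm, hG.2.2, hG.1 i j, max_comm, min_comm]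

theorem compress_quad (i j : Fin n) (x : Fin n → ℝ) :
    x ⬝ᵥ ((1 - φ • compress G i j) *ᵥ x) =
      x ⬝ᵥ ((1 - φ • G) *ᵥ x) - 2 * φ * ((x i - x j) * (excess G i j ⬝ᵥ x)) := by
  have h : (1 - φ • compress G i j) = (1 - φ • G) -
      φ • (Matrix.vecMulVec (Pi.single i 1 - Pi.single j 1) (excess G i j) +
        Matrix.vecMulVec (excess G i j) (Pi.single i 1 - Pi.single j 1)) := by
    rw [compress, smul_add]; abel
  rw [h, Matrix.sub_mulVec, Matrix.smul_mulVec, Matrix.add_mulVec, Matrix.vecMulVec_mulVec,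
    Matrix.vecMulVec_mulVec]
  simp only [sub_dotProduct, dotProduct_sub, dotProduct_add, dotProduct_smul,
    op_smul_eq_smul, smul_eq_mul, single_dotProduct, dotProduct_single, one_mul,
    mul_one, dotProduct_comm x (excess G i j)]
  ring

/-- The old centrality vector serves as trial vector for the compressed network: the quadratic form
drops by a nonnegative multiple of `x i - x j`. In case of equality `x` would solve both systems,
but row `i` has strictly gained weight. -/
theorem aggregateKB_le_compress_of_le (hG : IsAdmissible φ G) {i j : Fin n} (hij : i ≠ j)
    (hH : IsAdmissible φ (compress G i j)) (hx : katzBonacich φ G j ≤ katzBonacich φ G i) :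
    aggregateKB φ G ≤ aggregateKB φ (compress G i j) ∧
      ((∃ l, l ≠ i ∧ l ≠ j ∧ G i l < G j l) →
        aggregateKB φ G < aggregateKB φ (compress G i j)) := by
  set x := katzBonacich φ G with hxdef
  have hd : 0 ≤ excess G i j ⬝ᵥ x :=
    Finset.sum_nonneg fun b _ => mul_nonneg (excess_nonneg i j b) (hG.katzBonacich_pos b).le
  have h1 : aggregateKB φ G ≤ 2 * ∑ a, x a - x ⬝ᵥ ((1 - φ • compress G i j) *ᵥ x) := by
    rw [hG.aggregateKB_eq, compress_quad, ← hxdef]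
    have := mul_nonneg (mul_nonneg zero_le_two hG.pos.le) (mul_nonneg (sub_nonneg.2 hx) hd)
    linarith
  refine ⟨h1.trans (hH.le_aggregateKB x), ?_⟩
  rintro ⟨l, hli, hlj, hl⟩
  refine lt_of_le_of_ne (h1.trans (hH.le_aggregateKB x)) fun heq => ?_
  have h2 := hH.eq_katzBonacich (heq ▸ h1)
  have h3 := hH.katzBonacich_eq i
  have h4 := hG.katzBonacich_eq i
  rw [← h2] at h3
  rw [← hxdef, h3] at h4
  have h5 : (compress G i j *ᵥ x) i = (G *ᵥ x) i + excess G i j ⬝ᵥ x := by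
    rw [compress, Matrix.add_mulVec, Matrix.add_mulVec, Matrix.vecMulVec_mulVec,
      Matrix.vecMulVec_mulVec]
    simp [hij, excess]
  have h6 : 0 < excess G i j ⬝ᵥ x := by
    refine Finset.sum_pos' (fun b _ => mul_nonneg (excess_nonneg i j b)
      (hG.katzBonacich_pos b).le) ⟨l, Finset.mem_univ l, mul_pos ?_ (hG.katzBonacich_pos l)⟩
    rw [excess, if_neg (by tauto)]
    exact sub_pos.2 (lt_max_of_lt_right hl)
  have h7 := mul_left_cancel₀ hG.pos.ne' (add_left_cancel h4)
  linarith

/-- Compression does not decrease aggregate centrality, and it increases it unless the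
neighbourhoods of the two nodes are nested. -/
theorem aggregateKB_le_compress (hG : IsAdmissible φ G) (hGn : G ∈ networks n) {i j : Fin n}
    (hij : i ≠ j)
    (hH : IsAdmissible φ (compress G i j)) (hH' : IsAdmissible φ (compress G j i)) :
    aggregateKB φ G ≤ aggregateKB φ (compress G i j) ∧
      ((∃ l, l ≠ i ∧ l ≠ j ∧ G i l < G j l) → (∃ l, l ≠ i ∧ l ≠ j ∧ G j l < G i l) →
        aggregateKB φ G < aggregateKB φ (compress G i j)) := by
  rcases le_total (katzBonacich φ G j) (katzBonacich φ G i) with h | h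
  · have := aggregateKB_le_compress_of_le hG hij hH h
    exact ⟨this.1, fun h1 _ => this.2 h1⟩
  · have := aggregateKB_le_compress_of_le hG hij.symm hH' h
    have e : aggregateKB φ (compress G j i) = aggregateKB φ (compress G i j) := by
      rw [← compress_swap hGn hij]
      exact aggregateKB_submatrix _ hH (by rwa [compress_swap hGn hij])
    rw [e] at this
    exact ⟨this.1, fun _ ⟨l, h1, h2, h3⟩ => this.2 ⟨l, h2, h1, h3⟩⟩

/-! ### Nestedness of optimal unweighted paths -/

theorem isNSG_of_isSolution (hD : ∀ t ∈ Finset.Icc 1 T, 0 ≤ D t)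
    (hadm : ∀ s ∈ weightedPaths n T, ∀ t ≤ T, IsAdmissible φ (s t))
    (hs : IsSolution φ T D s) {t : ℕ} (ht : t ∈ Finset.Icc 1 T) (hDt : 0 < D t)
    (hu : IsUnweighted (s t)) : IsNSG (s t) := by
  refine ⟨hu, fun i j hij => ?_⟩
  by_contra hcon
  rw [not_or, Set.not_subset, Set.not_subset] at hcon
  obtain ⟨⟨k, ⟨hk1, hk2⟩, hk3⟩, ⟨l, ⟨hl1, hl2⟩, hl3⟩⟩ := hcon
  have hcomp : ∀ r ≤ T, aggregateKB φ (s r) ≤ aggregateKB φ (compress (s r) i j) ∧ _ := fun r hr =>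
    aggregateKB_le_compress (hadm s hs.1 r hr) (networks_of_mem_weightedPaths hs.1 hr) hij
      (hadm _ (compress_mem_weightedPaths hs.1 hij) r hr)
      (hadm _ (compress_mem_weightedPaths hs.1 hij.symm) r hr)
  -- The entire path is compressed: no period loses, and period `t` gains strictly.
  refine absurd (hs.2 _ (compress_mem_weightedPaths hs.1 hij)) (not_le.2 ?_)
  have htT := (Finset.mem_Icc.1 ht).2
  refine Finset.sum_lt_sum (fun r hr => mul_le_mul_of_nonneg_left
    (hcomp r (Finset.mem_Icc.1 hr).2).1 (hD r hr))
    ⟨t, ht, mul_lt_mul_of_pos_left ((hcomp t htT).2 ⟨l, ?_⟩ ⟨k, ?_⟩) hDt⟩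
  · have hlj : l ≠ j := by
      rintro rfl
      have h1 : s t l l = 1 := hl1
      rw [hu.1.2.2] at h1
      norm_num at h1
    have h1 : s t j l = 1 := hl1
    have h2 : s t i l ≠ 1 := fun h => hl3 ⟨h, hlj⟩
    rw [h1, (hu.2 i l).resolve_right h2]
    exact ⟨hl2, hlj, one_pos⟩
  · have hki : k ≠ i := by
      rintro rfl
      have h1 : s t k k = 1 := hk1
      rw [hu.1.2.2] at h1
      norm_num at h1
    have h1 : s t i k = 1 := hk1
    have h2 : s t j k ≠ 1 := fun h => hk3 ⟨h, hki⟩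
    rw [h1, (hu.2 j k).resolve_right h2]
    exact ⟨hki, hk2, one_pos⟩

/-- If `k` were at least as central as `j`, the mutual link would favour `j`, and so would the
remaining nested neighbourhoods, strictly at `i`. -/
theorem katzBonacich_lt_of_nested (hG : IsAdmissible φ G) {j k i : Fin n} (hd : ∀ a, G a a = 0)
    (hn : ∀ l, l ≠ j → l ≠ k → G k l ≤ G j l) (hij : i ≠ j) (hik : i ≠ k) (hi : G k i < G j i) :
    katzBonacich φ G k < katzBonacich φ G j := by
  set x := katzBonacich φ G with hx
  by_contra! hle
  have h1 := hG.katzBonacich_eq j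
  have h2 := hG.katzBonacich_eq k
  rw [← hx] at h1 h2
  have h3 : (G *ᵥ x) k < (G *ᵥ x) j := by
    rw [← sub_pos, mulVec_apply_eq_sum, mulVec_apply_eq_sum, ← Finset.sum_sub_distrib]
    have hjk : j ≠ k := by rintro rfl; exact hi.false
    have e : ∑ l, (G j l * x l - G k l * x l) =
        G j k * (x k - x j) + ∑ l ∈ (Finset.univ.erase j).erase k, (G j l - G k l) * x l := by
      rw [← Finset.add_sum_erase _ _ (Finset.mem_univ j),
        ← Finset.add_sum_erase _ _ (Finset.mem_erase.2 ⟨hjk.symm, Finset.mem_univ k⟩), hd j, hd k,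
        hG.symm k j, ← add_assoc]
      congr 1
      · ring
      · exact Finset.sum_congr rfl fun _ _ => by ring
    rw [e]
    refine add_pos_of_nonneg_of_pos (mul_nonneg (hG.nonneg j k) (sub_nonneg.2 hle)) ?_
    refine Finset.sum_pos' (fun l hl => ?_)
      ⟨i, by simp [hij, hik], mul_pos (sub_pos.2 hi) (hG.katzBonacich_pos i)⟩
    simp only [Finset.mem_erase] at hl
    exact mul_nonneg (sub_nonneg.2 (hn l hl.2.1 hl.1)) (hG.katzBonacich_pos l).le
  have := mul_lt_mul_of_pos_left h3 hG.pos
  linarith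

/-- In a nested split graph every neighbour of a node is more central than every other
non-neighbour; this is what lets centralities determine the graph. -/
theorem IsNSG.katzBonacich_lt (hG : IsAdmissible φ G) (hN : IsNSG G) {i j k : Fin n}
    (hjk : j ≠ k) (hj : G i j = 1) (hk : G i k = 0) (hik : i ≠ k) :
    katzBonacich φ G k < katzBonacich φ G j := by
  have hd := hN.1.1.2.2
  have hij : i ≠ j := by rintro rfl; rw [hd] at hj; norm_num at hj
  have hji : G j i = 1 := by rw [hG.symm, hj]
  have hki : G k i = 0 := by rw [hG.symm, hk]
  refine katzBonacich_lt_of_nested hG hd (i := i) (fun l hlj hlk => ?_) hij hik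
    (by rw [hji, hki]; norm_num)
  rcases hN.2 j k hjk with h | h
  · have : G k i = 1 := (h ⟨hji, hik⟩).1
    rw [hki] at this
    norm_num at this
  · rcases hN.1.2 k l with h0 | h1
    · rw [h0]; exact hG.nonneg _ _
    · rw [h1, show G j l = 1 from (h ⟨h1, hlj⟩).1]

/-- A nested split graph is determined by its vector of centralities. -/
theorem IsNSG.eq_of_katzBonacich_eq (hG : IsAdmissible φ G) (hH : IsAdmissible φ H)
    (hGN : IsNSG G) (hHN : IsNSG H) (h : katzBonacich φ G = katzBonacich φ H) : G = H := by
  have key : ∀ {G H : Matrix (Fin n) (Fin n) ℝ}, IsAdmissible φ G → IsAdmissible φ H → IsNSG G →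
      IsNSG H → katzBonacich φ G = katzBonacich φ H → ∀ i j, G i j = 1 → H i j = 1 := by
    intro G H hG hH hGN hHN h i j hij
    by_contra hne
    have h0 := (hHN.1.2 i j).resolve_right hne
    have h1 := hG.katzBonacich_eq i
    have h2 := hH.katzBonacich_eq i
    rw [← h] at h2
    have h3 : (G *ᵥ katzBonacich φ G) i = (H *ᵥ katzBonacich φ G) i :=
      mul_left_cancel₀ hG.pos.ne' (add_left_cancel (h1.symm.trans h2))
    rw [mulVec_apply_eq_sum, mulVec_apply_eq_sum] at h3
    -- Row `i` has the same centrality-weighted sum in both networks, so losing `j` must be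
    -- compensated by gaining some `k`. The two graphs then order `j` and `k` oppositely.
    have h4 : ∃ k, G i k < H i k := by
      by_contra! hle
      refine h3.not_gt (Finset.sum_lt_sum (fun k _ => mul_le_mul_of_nonneg_right (hle k)
        (hG.katzBonacich_pos k).le) ⟨j, Finset.mem_univ j, ?_⟩)
      rw [hij, h0, zero_mul, one_mul]
      exact hG.katzBonacich_pos j
    obtain ⟨k, hk⟩ := h4
    have hGk : G i k = 0 := by
      rcases hGN.1.2 i k with h | h
      · exact h
      · have := (hHN.1.1.2.1 i k).2; linarith
    have hHk : H i k = 1 := by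
      rcases hHN.1.2 i k with h | h
      · linarith
      · exact h
    have hik : i ≠ k := by rintro rfl; rw [hHN.1.1.2.2] at hHk; norm_num at hHk
    have hii : i ≠ j := by rintro rfl; rw [hGN.1.1.2.2] at hij; norm_num at hij
    have hjk : j ≠ k := by rintro rfl; rw [hij] at hGk; norm_num at hGk
    have c1 := hGN.katzBonacich_lt hG hjk hij hGk hik
    have c2 := hHN.katzBonacich_lt hH hjk.symm hHk h0 hii
    rw [h] at c1
    exact c1.not_gt c2
  ext i j
  rcases hGN.1.2 i j with h1 | h1 <;> rcases hHN.1.2 i j with h2 | h2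
  · rw [h1, h2]
  · have := key hH hG hHN hGN h.symm i j h2; rw [h1] at this; norm_num at this
  · have := key hG hH hGN hHN h i j h1; rw [h2] at this; norm_num at this
  · rw [h1, h2]

/-! ### Decomposition of weighted paths -/

/-- A nonnegative array with unit row sums and column sums at most one is the upper part of a
convex combination of permutation matrices. -/
theorem exists_perm_decomposition {m : ℕ} (hT : T ≤ m) {y : ℕ → Fin m → ℝ}
    (hy : ∀ r < T, ∀ c, 0 ≤ y r c) (hrow : ∀ r < T, ∑ c, y r c = 1)
    (hcol : ∀ c, ∑ r ∈ Finset.range T, y r c ≤ 1) :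
    ∃ w : Equiv.Perm (Fin m) → ℝ, (∀ σ, 0 ≤ w σ) ∧ ∑ σ, w σ = 1 ∧
      ∀ r c : Fin m, (r : ℕ) < T → y r c = ∑ σ, w σ * if σ r = c then 1 else 0 := by
  set f : Fin m → ℝ := fun c => ∑ r ∈ Finset.range T, y r c with hf
  have hsum : ∑ c, f c = T := by
    rw [hf, Finset.sum_comm, Finset.sum_congr rfl fun r hr => hrow r (Finset.mem_range.1 hr)]
    simp
  have hTm : (T : ℝ) ≤ m := by exact_mod_cast hT
  -- The remaining `m - T` rows share the missing mass of each column equally.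
  set M : Matrix (Fin m) (Fin m) ℝ :=
    Matrix.of fun r c => if (r : ℕ) < T then y r c else (1 - f c) / (m - T) with hM
  have hMds : M ∈ doublyStochastic ℝ (Fin m) := by
    rw [mem_doublyStochastic_iff_sum]
    refine ⟨fun r c => ?_, fun r => ?_, fun c => ?_⟩
    · simp only [hM, Matrix.of_apply]
      split_ifs with h
      · exact hy r h c
      · exact div_nonneg (sub_nonneg.2 (hcol c)) (sub_nonneg.2 hTm)
    · simp only [hM, Matrix.of_apply]
      split_ifs with h
      · exact hrow r h
      · rw [← Finset.sum_div, Finset.sum_sub_distrib, hsum]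
        have : (T : ℝ) < m := by exact_mod_cast (not_lt.1 h).trans_lt r.2
        simp only [Finset.sum_const, Finset.card_univ, Fintype.card_fin, nsmul_eq_mul, mul_one]
        exact div_self (sub_ne_zero.2 this.ne')
    · simp only [hM, Matrix.of_apply]
      rw [Fin.sum_univ_eq_sum_range (fun r => if r < T then y r c else (1 - f c) / (m - T)),
        ← Finset.sum_range_add_sum_Ico _ hT,
        Finset.sum_congr rfl fun r hr => if_pos (Finset.mem_range.1 hr),
        Finset.sum_congr rfl fun r hr => if_neg (not_lt.2 (Finset.mem_Ico.1 hr).1)]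
      rw [Finset.sum_const, Nat.card_Ico, nsmul_eq_mul, Nat.cast_sub hT]
      change f c + _ = 1
      -- If `m = T` there are no rows to fill, and the column sums must already equal one.
      by_cases hmT : (m : ℝ) - T = 0
      · rw [hmT, zero_mul, add_zero]
        have h0 : ∑ c, (1 - f c) = 0 := by
          rw [Finset.sum_sub_distrib, hsum]
          simpa using hmT
        have := (Finset.sum_eq_zero_iff_of_nonneg fun c _ => sub_nonneg.2 (hcol c)).1 h0 c
          (Finset.mem_univ c)
        linarith
      · rw [mul_div_cancel₀ _ hmT]
        ring
  obtain ⟨w, hw0, hw1, hw⟩ := exists_eq_sum_perm_of_mem_doublyStochastic hMds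
  refine ⟨w, hw0, hw1, fun r c hr => ?_⟩
  have : M r c = y r c := by simp [hM, hr]
  rw [← this, ← hw, Matrix.sum_apply]
  refine Finset.sum_congr rfl fun σ _ => ?_
  simp [Equiv.Perm.permMatrix, PEquiv.toMatrix_apply, eq_comm]

/-- The possible links, as ordered pairs of nodes. -/
abbrev Link (n : ℕ) : Type := {e : Fin n × Fin n // e.1 < e.2}

theorem linkMatrix_apply_link (e e' : Link n) :
    linkMatrix e.1.1 e.1.2 e'.1.1 e'.1.2 = if e = e' then 1 else 0 := by
  rw [linkMatrix_apply e.2.ne]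
  obtain ⟨⟨a, b⟩, h⟩ := e
  obtain ⟨⟨c, d⟩, h'⟩ := e'
  simp only [Subtype.mk.injEq, Prod.mk.injEq] at h h' ⊢
  congr 1
  rw [eq_iff_iff]
  constructor
  · rintro (⟨rfl, rfl⟩ | ⟨rfl, rfl⟩)
    · simp
    · exact absurd h h'.asymm
  · rintro ⟨rfl, rfl⟩; simp

theorem linkMatrix_mem_networks {i j : Fin n} (hij : i ≠ j) : linkMatrix i j ∈ networks n := by
  simpa using (isUnweighted_zero.add_linkMatrix hij rfl).1

theorem eq_sum_linkMatrix (hs : ∀ i j, G i j = G j i) (hd : ∀ i, G i i = 0) :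
    G = ∑ e : Link n, G e.1.1 e.1.2 • linkMatrix e.1.1 e.1.2 := by
  have key : ∀ a b (h : a < b), G a b =
      (∑ e : Link n, G e.1.1 e.1.2 • linkMatrix e.1.1 e.1.2) a b := by
    intro a b h
    have := fun e : Link n => linkMatrix_apply_link e ⟨(a, b), h⟩
    simp only at this
    simp only [Matrix.sum_apply, Matrix.smul_apply, this, smul_eq_mul, mul_ite, mul_one, mul_zero]
    simp
  ext a b
  rcases lt_trichotomy a b with h | rfl | h
  · exact key a b h
  · simp only [Matrix.sum_apply, Matrix.smul_apply]
    rw [hd, Finset.sum_eq_zero]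
    intro e _
    rw [(linkMatrix_mem_networks e.2.ne).2.2, smul_zero]
  · rw [hs, key b a h, Matrix.sum_apply, Matrix.sum_apply]
    refine Finset.sum_congr rfl fun e _ => ?_
    rw [Matrix.smul_apply, Matrix.smul_apply, (linkMatrix_mem_networks e.2.ne).1]

theorem total_eq_two_mul (hs : ∀ i j, G i j = G j i) (hd : ∀ i, G i i = 0) :
    ∑ i, ∑ j, G i j = 2 * ∑ e : Link n, G e.1.1 e.1.2 := by
  conv_lhs => rw [eq_sum_linkMatrix hs hd]
  rw [← total_eq_sum, Matrix.sum_mulVec, dotProduct_sum, Finset.mul_sum]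
  refine Finset.sum_congr rfl fun e _ => ?_
  rw [Matrix.smul_mulVec, dotProduct_smul, total_eq_sum, total_linkMatrix, smul_eq_mul, mul_comm]

/-- Every weighted path is a convex combination of unweighted paths. -/
theorem exists_linkPaths_decomposition (hs : s ∈ weightedPaths n T) :
    ∃ (ι : Type) (_ : Fintype ι) (w : ι → ℝ) (p : ι → ℕ → Matrix (Fin n) (Fin n) ℝ),
      (∀ a, 0 ≤ w a) ∧ ∑ a, w a = 1 ∧ (∀ a, p a ∈ linkPaths n T) ∧
        ∀ t ≤ T, s t = ∑ a, w a • p a t := by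
  have hs' := mem_weightedPaths_iff.1 hs
  have hnet := fun t (ht : t ≤ T) => networks_of_mem_weightedPaths hs ht
  have htot : ∀ t ≤ T, ∑ e : Link n, s t e.1.1 e.1.2 = t := fun t ht => by
    have h1 := total_of_mem_weightedPaths hs ht
    rw [total_eq_two_mul (hnet t ht).1 (hnet t ht).2.2] at h1
    linarith
  set m := Fintype.card (Link n) with hm
  let E : Link n ≃ Fin m := Fintype.equivFin _
  let lk : Fin m → Matrix (Fin n) (Fin n) ℝ := fun c =>
    linkMatrix (E.symm c).1.1 (E.symm c).1.2
  let y : ℕ → Fin m → ℝ := fun r c =>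
    s (r + 1) (E.symm c).1.1 (E.symm c).1.2 - s r (E.symm c).1.1 (E.symm c).1.2
  have hsumE : ∀ t, ∑ c, s t (E.symm c).1.1 (E.symm c).1.2 = ∑ e : Link n, s t e.1.1 e.1.2 :=
    fun t => Equiv.sum_comp E.symm fun e : Link n => s t e.1.1 e.1.2
  -- A feasible path cannot place more than one unit of weight on each possible link.
  have hT : T ≤ m := by
    have h1 := htot T le_rfl
    have h2 : ∑ e : Link n, s T e.1.1 e.1.2 ≤ ∑ e : Link n, (1 : ℝ) :=
      Finset.sum_le_sum fun e _ => ((hnet T le_rfl).2.1 _ _).2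
    rw [h1] at h2
    simp only [Finset.sum_const, Finset.card_univ, nsmul_eq_mul, mul_one] at h2
    exact_mod_cast h2
  obtain ⟨w, hw0, hw1, hw⟩ := exists_perm_decomposition hT (y := y)
    (fun r hr c => sub_nonneg.2 ((hs'.2 r hr).2.1 _ _))
    (fun r hr => by
      simp only [y, Finset.sum_sub_distrib, hsumE, htot (r + 1) hr, htot r hr.le]
      push_cast; ring)
    (fun c => by
      simp only [y]
      rw [Finset.sum_range_sub (fun r => s r (E.symm c).1.1 (E.symm c).1.2), hs.1]
      simpa using ((hnet T le_rfl).2.1 _ _).2)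
  -- A permutation is read as an order of link formation: link `σ r` is added in period `r + 1`. The
  -- default `0` is never reached for `t ≤ T`.
  let p : Equiv.Perm (Fin m) → ℕ → Matrix (Fin n) (Fin n) ℝ := fun σ t =>
    ∑ r ∈ Finset.range t, if h : r < m then lk (σ ⟨r, h⟩) else 0
  have hp : ∀ σ t (ht : t < m), p σ (t + 1) = p σ t + lk (σ ⟨t, ht⟩) := by
    intro σ t ht
    simp only [p, Finset.sum_range_succ, dif_pos ht]
  refine ⟨_, inferInstance, w, p, hw0, hw1, fun σ => ⟨by simp [p], fun t ht => ?_⟩, ?_⟩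
  · refine ⟨_, _, (E.symm (σ ⟨t, ht.trans_le hT⟩)).2.ne, ?_, hp σ t (ht.trans_le hT)⟩
    simp only [p, Matrix.sum_apply]
    refine Finset.sum_eq_zero fun r hr => ?_
    have hrt := Finset.mem_range.1 hr
    rw [dif_pos (hrt.trans (ht.trans_le hT))]
    refine (linkMatrix_apply_link (E.symm (σ ⟨r, _⟩)) (E.symm (σ ⟨t, _⟩))).trans (if_neg ?_)
    intro h
    have := congrArg Fin.val (σ.injective (E.symm.injective h))
    exact hrt.ne this
  · intro t
    induction t with
    | zero => intro _; simp [hs.1, p]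
    | succ t ih =>
      intro ht
      have ht' : t < m := Nat.lt_of_lt_of_le ht hT
      have h1 : s (t + 1) = s t + ∑ c, y t c • lk c := by
        have e1 := eq_sum_linkMatrix (hnet _ ht).1 (hnet _ ht).2.2
        have e2 := eq_sum_linkMatrix (hnet _ (Nat.le_of_succ_le ht)).1
          (hnet _ (Nat.le_of_succ_le ht)).2.2
        have e3 : ∑ c, y t c • lk c = ∑ e : Link n,
            (s (t + 1) e.1.1 e.1.2 - s t e.1.1 e.1.2) • linkMatrix e.1.1 e.1.2 :=
          Equiv.sum_comp E.symm fun e : Link n =>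
            (s (t + 1) e.1.1 e.1.2 - s t e.1.1 e.1.2) • linkMatrix e.1.1 e.1.2
        rw [e3]
        simp only [sub_smul, Finset.sum_sub_distrib]
        rw [← e1, ← e2]
        abel
      have h2 : ∑ c, y t c • lk c = ∑ σ, w σ • lk (σ ⟨t, ht'⟩) := by
        have : ∀ c, y t c = ∑ σ, w σ * if σ ⟨t, ht'⟩ = c then 1 else 0 :=
          fun c => hw ⟨t, ht'⟩ c ht
        simp only [this, Finset.sum_smul]
        rw [Finset.sum_comm]
        refine Finset.sum_congr rfl fun σ _ => ?_
        simp
      rw [h1, h2, ih (Nat.le_of_succ_le ht), ← Finset.sum_add_distrib]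
      refine Finset.sum_congr rfl fun σ _ => ?_
      rw [hp σ t ht', smul_add]

/-- A solution agrees with an unweighted solution at all periods of positive weight, and is a
nested split graph there. -/
theorem exists_linkPaths_solution (hD : ∀ t ∈ Finset.Icc 1 T, 0 ≤ D t)
    (hadm : ∀ s ∈ weightedPaths n T, ∀ t ≤ T, IsAdmissible φ (s t)) (hs : IsSolution φ T D s) :
    ∃ p ∈ linkPaths n T, IsSolution φ T D p ∧
      ∀ t ∈ Finset.Icc 1 T, 0 < D t → s t = p t ∧ IsNSG (p t) := by
  obtain ⟨ι, _, w, p, hw0, hw1, hp, hsp⟩ := exists_linkPaths_decomposition hs.1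
  have hpw := fun a => linkPaths_subset_weightedPaths (hp a)
  have hJ : ∀ t ∈ Finset.Icc 1 T, _ := fun t ht =>
    aggregateKB_sum_le hw0 hw1 (hadm s hs.1 t (Finset.mem_Icc.1 ht).2)
      (fun a => hadm _ (hpw a) t (Finset.mem_Icc.1 ht).2) (hsp t (Finset.mem_Icc.1 ht).2)
  have hle : ∀ t ∈ Finset.Icc 1 T, D t * aggregateKB φ (s t) ≤
      D t * ∑ a, w a * aggregateKB φ (p a t) := fun t ht =>
    mul_le_mul_of_nonneg_left (hJ t ht).1 (hD t ht)
  have hswap : ∑ t ∈ Finset.Icc 1 T, D t * ∑ a, w a * aggregateKB φ (p a t) =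
      ∑ a, w a * payoff φ T D (p a) := by
    simp only [payoff, Finset.mul_sum]
    rw [Finset.sum_comm]
    exact Finset.sum_congr rfl fun _ _ => Finset.sum_congr rfl fun _ _ => by ring
  have hle2 : ∀ a ∈ Finset.univ, w a * payoff φ T D (p a) ≤ w a * payoff φ T D s := fun a _ =>
    mul_le_mul_of_nonneg_left (hs.2 _ (hpw a)) (hw0 a)
  have hsum2 : ∑ a, w a * payoff φ T D s = payoff φ T D s := by
    rw [← Finset.sum_mul, hw1, one_mul]
  -- Jensen bounds the payoff by the mixture and optimality bounds the mixture by the payoff. Both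
  -- are therefore equalities, term by term.
  have h1 : payoff φ T D s ≤ ∑ a, w a * payoff φ T D (p a) := hswap ▸ Finset.sum_le_sum hle
  have h2 : ∑ a, w a * payoff φ T D (p a) ≤ payoff φ T D s := hsum2 ▸ Finset.sum_le_sum hle2
  have hopt : ∀ a, 0 < w a → IsSolution φ T D (p a) := by
    intro a ha
    have := (Finset.sum_eq_sum_iff_of_le hle2).1 (by rw [hsum2]; exact le_antisymm h2 h1) a
      (Finset.mem_univ a)
    have := mul_left_cancel₀ ha.ne' this
    exact ⟨hpw a, fun s' hs' => this ▸ hs.2 s' hs'⟩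
  have hkb : ∀ t ∈ Finset.Icc 1 T, 0 < D t → ∀ a, 0 < w a →
      katzBonacich φ (p a t) = katzBonacich φ (s t) := by
    intro t ht hDt
    refine (hJ t ht).2 ?_
    have := (Finset.sum_eq_sum_iff_of_le hle).1
      (le_antisymm (Finset.sum_le_sum hle) (by rw [hswap]; exact h2)) t ht
    exact (mul_left_cancel₀ hDt.ne' this).ge
  have hN : ∀ t ∈ Finset.Icc 1 T, 0 < D t → ∀ a, 0 < w a → IsNSG (p a t) :=
    fun t ht hDt a ha => isNSG_of_isSolution hD hadm (hopt a ha) ht hDt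
      (isUnweighted_of_mem_linkPaths (hp a) (Finset.mem_Icc.1 ht).2)
  obtain ⟨a, -, ha⟩ : ∃ a ∈ Finset.univ, 0 < w a := by
    refine Finset.exists_lt_of_sum_lt (f := fun _ => (0 : ℝ)) ?_
    rw [hw1]; simp
  refine ⟨p a, hp a, hopt a ha, fun t ht hDt => ⟨?_, hN t ht hDt a ha⟩⟩
  have htT := (Finset.mem_Icc.1 ht).2
  rw [hsp t htT]
  have : ∀ b ∈ Finset.univ, w b • p b t = w b • p a t := by
    intro b _
    rcases (hw0 b).eq_or_lt with h | h
    · rw [← h, zero_smul, zero_smul]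
    · rw [(hN t ht hDt b h).eq_of_katzBonacich_eq (hadm _ (hpw b) t htT) (hadm _ (hpw a) t htT)
        (hN t ht hDt a ha) ((hkb t ht hDt b h).trans (hkb t ht hDt a ha).symm)]
  rw [Finset.sum_congr rfl this, ← Finset.sum_smul, hw1, one_smul]

/-! ### Greedy paths -/

/-- The path `s` only witnesses that there is room: its final weight exceeds that of `p t`, so some
entry of `p t` is smaller and marks an absent link. -/
theorem exists_linkPaths_extension {p s : ℕ → Matrix (Fin n) (Fin n) ℝ}
    (hs : s ∈ weightedPaths n T) {t : ℕ} (ht : t ≤ T) (hp : p ∈ linkPaths n t) :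
    ∃ q ∈ linkPaths n T, ∀ r ≤ t, q r = p r := by
  induction ht using Nat.decreasingInduction generalizing p with
  | self => exact ⟨p, hp, fun _ _ => rfl⟩
  | of_succ t ht ih =>
    have hu := isUnweighted_of_mem_linkPaths hp le_rfl
    obtain ⟨i, j, hij⟩ : ∃ i j, p t i j < s T i j := by
      by_contra! hle
      have h1 := total_of_mem_weightedPaths hs le_rfl
      have h2 := total_of_mem_weightedPaths (linkPaths_subset_weightedPaths hp) le_rfl
      have h3 : ∑ i, ∑ j, s T i j ≤ ∑ i, ∑ j, p t i j :=
        Finset.sum_le_sum fun i _ => Finset.sum_le_sum fun j _ => hle i j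
      rw [h1, h2] at h3
      have : (t : ℝ) < T := by exact_mod_cast ht
      linarith
    have hnet := networks_of_mem_weightedPaths hs le_rfl
    have h0 : p t i j = 0 := (hu.2 i j).resolve_right fun h => by
      have := (hnet.2.1 i j).2; linarith
    have hne : i ≠ j := by
      rintro rfl
      rw [hu.1.2.2, hnet.2.2] at hij
      exact hij.false
    have hmem : Function.update p (t + 1) (p t + linkMatrix i j) ∈ linkPaths n (t + 1) := by
      refine ⟨by rw [Function.update_of_ne (by omega)]; exact hp.1, fun r hr => ?_⟩
      rw [Function.update_of_ne (show r ≠ t + 1 by omega)]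
      rcases Nat.lt_succ_iff_lt_or_eq.1 hr with h | rfl
      · rw [Function.update_of_ne (by omega)]
        exact hp.2 r h
      · rw [Function.update_self]
        exact ⟨i, j, hne, h0, rfl⟩
    obtain ⟨q, hq, hqr⟩ := ih hmem
    exact ⟨q, hq, fun r hr => by rw [hqr r (by omega), Function.update_of_ne (by omega)]⟩

theorem exists_linkPaths_of_mem_linkSucc (hs : s ∈ linkPaths n T) {t : ℕ} (ht : t < T)
    (hH : H ∈ linkSucc (s t)) : ∃ q ∈ linkPaths n T, (∀ r ≤ t, q r = s r) ∧ q (t + 1) = H := by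
  have hmem : Function.update s (t + 1) H ∈ linkPaths n (t + 1) := by
    refine ⟨by rw [Function.update_of_ne (by omega)]; exact hs.1, fun r hr => ?_⟩
    rw [Function.update_of_ne (show r ≠ t + 1 by omega)]
    rcases Nat.lt_succ_iff_lt_or_eq.1 hr with h | rfl
    · rw [Function.update_of_ne (by omega)]
      exact hs.2 r (h.trans ht)
    · rwa [Function.update_self]
  obtain ⟨q, hq, hqr⟩ := exists_linkPaths_extension (linkPaths_subset_weightedPaths hs) ht hmem
  refine ⟨q, hq, fun r hr => ?_, by rw [hqr _ le_rfl, Function.update_self]⟩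
  rw [hqr r (by omega), Function.update_of_ne (by omega)]

/-- Under a myopic objective, each network of an unweighted solution is optimal among the
unweighted successors of the preceding one. -/
theorem aggregateKB_le_of_mem_linkSucc (hmy : IsMyopic n φ T D)
    (hs : IsSolution φ T D s) (hsl : s ∈ linkPaths n T) {t : ℕ} (ht : t < T)
    (hH : H ∈ linkSucc (s t)) : aggregateKB φ H ≤ aggregateKB φ (s (t + 1)) := by
  obtain ⟨q, hq, hqr, hqt⟩ := exists_linkPaths_of_mem_linkSucc hsl ht hH
  by_contra! hlt
  exact (hs.2 q (linkPaths_subset_weightedPaths hq)).not_gt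
    (hmy q hq s hsl (t + 1) (Finset.mem_Icc.2 ⟨by omega, ht⟩)
      (fun r _ hr => by rw [hqr r (by omega)]) (by rwa [hqt]))

/-! ### Comparison of successors -/

/-- Each product pairs centralities from both networks, so the comparisons below need only crude
one-step bounds in each. -/
theorem aggregateKB_add_linkMatrix_sub {a b c d : Fin n}
    (h : IsAdmissible φ (G + linkMatrix a b)) (h' : IsAdmissible φ (G + linkMatrix c d)) :
    aggregateKB φ (G + linkMatrix a b) - aggregateKB φ (G + linkMatrix c d) =
      φ * (katzBonacich φ (G + linkMatrix c d) a * katzBonacich φ (G + linkMatrix a b) b +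
        katzBonacich φ (G + linkMatrix c d) b * katzBonacich φ (G + linkMatrix a b) a -
        katzBonacich φ (G + linkMatrix c d) c * katzBonacich φ (G + linkMatrix a b) d -
        katzBonacich φ (G + linkMatrix c d) d * katzBonacich φ (G + linkMatrix a b) c) := by
  rw [h'.aggregateKB_sub_aggregateKB h, add_sub_add_left_eq_sub, Matrix.sub_mulVec,
    linkMatrix_mulVec, linkMatrix_mulVec]
  simp only [dotProduct_sub, dotProduct_add, dotProduct_single]
  ring

namespace IsAdmissible

theorem one_add_sum_le (hG : IsAdmissible φ G) {k : Fin n} (S : Finset (Fin n))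
    (hS : ∀ l ∈ S, 1 ≤ G k l) : 1 + φ * ∑ l ∈ S, katzBonacich φ G l ≤ katzBonacich φ G k := by
  rw [hG.katzBonacich_eq k, mulVec_apply_eq_sum]
  have h1 : ∑ l ∈ S, katzBonacich φ G l ≤ ∑ l ∈ S, G k l * katzBonacich φ G l :=
    Finset.sum_le_sum fun l hl => le_mul_of_one_le_left (hG.katzBonacich_pos l).le (hS l hl)
  have h2 : ∑ l ∈ S, G k l * katzBonacich φ G l ≤ ∑ l, G k l * katzBonacich φ G l :=
    Finset.sum_le_sum_of_subset_of_nonneg (Finset.subset_univ S)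
      fun l _ _ => mul_nonneg (hG.nonneg k l) (hG.katzBonacich_pos l).le
  have := mul_le_mul_of_nonneg_left (h1.trans h2) hG.pos.le
  linarith

theorem one_add_le (hG : IsAdmissible φ G) {k l : Fin n} (h : 1 ≤ G k l) :
    1 + φ * katzBonacich φ G l ≤ katzBonacich φ G k := by
  simpa using hG.one_add_sum_le {l} (by simpa using h)

theorem one_add_add_le (hG : IsAdmissible φ G) {k l m : Fin n} (hlm : l ≠ m) (hl : 1 ≤ G k l)
    (hm : 1 ≤ G k m) :
    1 + φ * (katzBonacich φ G l + katzBonacich φ G m) ≤ katzBonacich φ G k := by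
  have := hG.one_add_sum_le {l, m} (by simpa using ⟨hl, hm⟩)
  rwa [Finset.sum_pair hlm] at this

theorem eq_one_of_isolated (hG : IsAdmissible φ G) {u : Fin n} (hu : ∀ l, G u l = 0) :
    katzBonacich φ G u = 1 := by
  rw [hG.katzBonacich_eq u, mulVec_apply_eq_sum]
  simp [hu]

end IsAdmissible

theorem add_linkMatrix_isolated {u a b : Fin n} (hu : ∀ l, G u l = 0) (hua : u ≠ a) (hub : u ≠ b)
    (l : Fin n) : (G + linkMatrix a b) u l = 0 := by
  simp [linkMatrix, hu, hua.symm, hub.symm]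

theorem katzBonacich_pendant {u w : Fin n} (h : IsAdmissible φ (G + linkMatrix u w))
    (huw : u ≠ w) (hu : ∀ l, G u l = 0) :
    katzBonacich φ (G + linkMatrix u w) u = 1 + φ * katzBonacich φ (G + linkMatrix u w) w := by
  have h1 := h.katzBonacich_eq u
  have h2 : (G *ᵥ katzBonacich φ (G + linkMatrix u w)) u = 0 := by
    simp [mulVec_apply_eq_sum, hu]
  have h3 : ((G + linkMatrix u w) *ᵥ katzBonacich φ (G + linkMatrix u w)) u =
      katzBonacich φ (G + linkMatrix u w) w := by
    rw [Matrix.add_mulVec, Pi.add_apply, h2, zero_add, linkMatrix_mulVec]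
    simp [huw]
  rwa [h3] at h1

theorem one_le_add_linkMatrix (hG : ∀ i j, 0 ≤ G i j) (i j : Fin n) :
    1 ≤ (G + linkMatrix i j) i j ∧ 1 ≤ (G + linkMatrix i j) j i := by
  simp only [linkMatrix, Matrix.add_apply, Matrix.single_apply, and_self, if_true]
  have := hG i j
  have := hG j i
  constructor <;> split_ifs <;> linarith

theorem le_add_linkMatrix (a b i j : Fin n) : G i j ≤ (G + linkMatrix a b) i j := by
  simp only [linkMatrix, Matrix.add_apply, Matrix.single_apply]
  split_ifs <;> linarith

/-- Linking an isolated node to `w` is worse than linking `w` to a node with a neighbour. -/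
theorem aggregateKB_pendant_lt (hG : ∀ i j, 0 ≤ G i j) {u w k j : Fin n} (huw : u ≠ w)
    (huk : u ≠ k) (hu : ∀ l, G u l = 0) (hkj : G k j = 1)
    (h : IsAdmissible φ (G + linkMatrix w k)) (h' : IsAdmissible φ (G + linkMatrix u w)) :
    aggregateKB φ (G + linkMatrix u w) < aggregateKB φ (G + linkMatrix w k) := by
  have hd := aggregateKB_add_linkMatrix_sub h h'
  have zu := h.eq_one_of_isolated (add_linkMatrix_isolated hu huw huk)
  have xu := katzBonacich_pendant h' huw hu
  have zk := h.one_add_le (one_le_add_linkMatrix hG w k).2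
  have xk := h'.one_add_le (hkj.ge.trans (le_add_linkMatrix u w k j))
  have xw := h'.katzBonacich_pos w
  have zw := h.katzBonacich_pos w
  have xj := mul_pos h.pos (h'.katzBonacich_pos j)
  rw [zu, xu] at hd
  rw [← sub_pos, hd]
  refine mul_pos h.pos ?_
  -- With `x` for the link `uw` and `z` for `wk`, everything cancels except `φ x_j z_w`.
  have e1 := mul_le_mul_of_nonneg_left zk xw.le
  have e2 := mul_le_mul_of_nonneg_right xk zw.le
  have e3 := mul_pos xj zw
  linarith

/-- Linking an isolated node to `k` is worse than linking to `k` a node with another neighbour. -/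
theorem aggregateKB_replace_isolated_lt (hG : ∀ i j, 0 ≤ G i j) {u k q j : Fin n} (huk : u ≠ k)
    (huq : u ≠ q) (hu : ∀ l, G u l = 0) (hqj : G q j = 1) (hjk : j ≠ k)
    (h : IsAdmissible φ (G + linkMatrix q k)) (h' : IsAdmissible φ (G + linkMatrix u k)) :
    aggregateKB φ (G + linkMatrix u k) < aggregateKB φ (G + linkMatrix q k) := by
  have hd := aggregateKB_add_linkMatrix_sub h h'
  have zu := h.eq_one_of_isolated (add_linkMatrix_isolated hu huq huk)
  have xu := katzBonacich_pendant h' huk hu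
  have zq := h.one_add_add_le hjk (hqj.ge.trans (le_add_linkMatrix q k q j))
    (one_le_add_linkMatrix hG q k).1
  have xq := h'.one_le_katzBonacich q
  have xk := h'.katzBonacich_pos k
  have zk := h.katzBonacich_pos k
  have zj := mul_pos h.pos (h.katzBonacich_pos j)
  rw [zu, xu] at hd
  rw [← sub_pos, hd]
  refine mul_pos h.pos ?_
  -- With `x` for the link `uk` and `z` for `qk`, what survives is `φ x_k z_j`.
  have e1 := mul_le_mul_of_nonneg_right xq zk.le
  have e2 := mul_le_mul_of_nonneg_left zq xk.le
  have e3 := mul_pos xk zj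
  linarith

theorem katzBonacich_sub (hG : IsAdmissible φ G) {i k : Fin n} {d : Fin n → ℝ}
    (hd : ∀ l, G i l = G k l + d l) :
    katzBonacich φ G i - katzBonacich φ G k = φ * (d ⬝ᵥ katzBonacich φ G) := by
  rw [hG.katzBonacich_eq i, hG.katzBonacich_eq k, mulVec_apply_eq_sum, mulVec_apply_eq_sum]
  simp only [hd, add_mul, Finset.sum_add_distrib, dotProduct]
  ring

/-- Let the neighbourhoods of the adjacent nodes `i` and `k` differ only in the node `q`, a
neighbour of `i`. Linking an isolated node to `i` is worse than linking `q` to `k`. -/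
theorem aggregateKB_complete_lt (hG : G ∈ networks n) {u i k q : Fin n} (hui : u ≠ i)
    (huk : u ≠ k) (huq : u ≠ q) (hik : i ≠ k) (hiq : i ≠ q) (hkq : k ≠ q)
    (hu : ∀ l, G u l = 0) (gik : G i k = 1) (giq : G i q = 1) (gkq : G k q = 0)
    (hrow : ∀ l, l ≠ i → l ≠ k → l ≠ q → G i l = G k l)
    (h : IsAdmissible φ (G + linkMatrix q k)) (h' : IsAdmissible φ (G + linkMatrix u i)) :
    aggregateKB φ (G + linkMatrix u i) < aggregateKB φ (G + linkMatrix q k) := by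
  have hd := aggregateKB_add_linkMatrix_sub h h'
  have gki : G k i = 1 := by rw [hG.1, gik]
  have gqi : G q i = 1 := by rw [hG.1, giq]
  have gii := hG.2.2 i
  have gkk := hG.2.2 k
  have giu : G i u = 0 := by rw [hG.1, hu]
  have gku : G k u = 0 := by rw [hG.1, hu]
  have zu := h.eq_one_of_isolated (add_linkMatrix_isolated hu huq huk)
  have xu := katzBonacich_pendant h' hui hu
  -- Once `q` is linked to `k`, the nodes `i` and `k` are adjacent twins, hence equally central.
  have zz := katzBonacich_sub h (i := i) (k := k) (d := Pi.single k 1 - Pi.single i 1) (by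
    intro l
    simp only [Matrix.add_apply, linkMatrix_apply hkq.symm, Pi.sub_apply, Pi.single_apply]
    by_cases h1 : l = i
    · subst h1; simp [*]
    by_cases h2 : l = k
    · subst h2; simp [*, hik.symm]
    by_cases h3 : l = q
    · subst h3; simp [*]
    simp [hrow l h1 h2 h3, h1, h2, h3])
  have xx := katzBonacich_sub h' (i := i) (k := k)
    (d := Pi.single k 1 - Pi.single i 1 + Pi.single q 1 + Pi.single u 1) (by
    intro l
    simp only [Matrix.add_apply, linkMatrix_apply hui, Pi.sub_apply, Pi.add_apply,
      Pi.single_apply]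
    by_cases h1 : l = i
    · subst h1; simp [*, hik.symm, hui.symm, huk.symm]
    by_cases h2 : l = k
    · subst h2; simp [*, hik.symm, hui.symm, huk.symm]
    by_cases h3 : l = q
    · subst h3; simp [*, hik.symm, hui.symm, huk.symm, huq.symm]
    by_cases h4 : l = u
    · subst h4; simp [*, hik.symm, hui.symm, huk.symm]
    simp [hrow l h1 h2 h3, h1, h2, h3, h4])
  simp only [sub_dotProduct, add_dotProduct, single_dotProduct, one_mul] at zz xx
  have zq := h.one_add_add_le hik (gqi.ge.trans (le_add_linkMatrix q k q i))
    (one_le_add_linkMatrix (fun i j => (hG.2.1 i j).1) q k).1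
  have xq := h'.one_add_le (gqi.ge.trans (le_add_linkMatrix u i q i))
  have xk := h'.one_add_le (gki.ge.trans (le_add_linkMatrix u i k i))
  have zk := h.one_le_katzBonacich k
  have xi := h'.one_le_katzBonacich i
  have hφ := h.pos
  set z := katzBonacich φ (G + linkMatrix q k)
  set x := katzBonacich φ (G + linkMatrix u i)
  have zik : z i = z k := by
    have : (1 + φ) * (z i - z k) = 0 := by linear_combination zz
    rcases mul_eq_zero.1 this with h0 | h0 <;> linarith
  rw [← sub_pos, hd]
  refine mul_pos hφ ?_
  rw [zik] at zq ⊢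
  rw [zu]
  have hφ1 : 0 < 1 + φ := by linarith
  have xx' : (1 + φ) * (x i - x k) = φ * (x q + x u) := by linear_combination xx
  -- The factor `1 + φ` allows `x i` to be eliminated by `xx'`. Since `x q` and `x k` are both at
  -- least `1 + φ x i = x u`, the remainder is at least `2 φ² x_k z_k`.
  refine pos_of_mul_pos_right (a := 1 + φ) ?_ hφ1.le
  have e1 : x k * (1 + φ * (2 * z k)) ≤ x k * z q :=
    mul_le_mul_of_nonneg_left (by linarith) (by nlinarith)
  have e2 : 0 ≤ (x q - x u) * (z k * (1 + φ) - φ) :=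
    mul_nonneg (by linarith) (by nlinarith)
  have e3 : x u * 1 ≤ x k * z k := mul_le_mul (by linarith) zk zero_le_one (by nlinarith)
  have e4 : 0 < φ * φ * (x k * z k) := mul_pos (mul_pos hφ hφ) (by nlinarith)
  have e5 := mul_le_mul_of_nonneg_left e1 hφ1.le
  have e6 := mul_le_mul_of_nonneg_left e3 hφ.le
  linarith

/-! ### Quasi-complete graphs -/

/-- The network with a complete subgraph on `P`, in which `q` is linked to the nodes of `R`. -/
noncomputable def quasiComplete (P : Finset (Fin n)) (q : Fin n) (R : Finset (Fin n)) :
    Matrix (Fin n) (Fin n) ℝ :=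
  Matrix.of fun i j =>
    if i ≠ j ∧ ((i ∈ P ∧ j ∈ P) ∨ (i ∈ R ∧ j = q) ∨ (i = q ∧ j ∈ R)) then 1 else 0

theorem quasiComplete_apply (P : Finset (Fin n)) (q : Fin n) (R : Finset (Fin n)) (i j : Fin n) :
    quasiComplete P q R i j =
      if i ≠ j ∧ ((i ∈ P ∧ j ∈ P) ∨ (i ∈ R ∧ j = q) ∨ (i = q ∧ j ∈ R)) then 1 else 0 := rfl

theorem quasiComplete_mem_networks (P : Finset (Fin n)) (q : Fin n) (R : Finset (Fin n)) :
    quasiComplete P q R ∈ networks n := by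
  refine ⟨fun i j => ?_, fun i j => ?_, fun i => ?_⟩
  · rw [quasiComplete_apply, quasiComplete_apply]
    congr 1
    grind
  · rw [quasiComplete_apply]
    split_ifs <;> norm_num
  · simp [quasiComplete_apply]

theorem quasiComplete_empty (P : Finset (Fin n)) (q q' : Fin n) :
    quasiComplete P q ∅ = quasiComplete P q' ∅ := by
  ext i j; simp [quasiComplete_apply]

theorem quasiComplete_self (P : Finset (Fin n)) (q : Fin n) :
    quasiComplete P q P = quasiComplete (insert q P) q ∅ := by
  ext i j
  rw [quasiComplete_apply, quasiComplete_apply]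
  congr 1
  grind

theorem quasiComplete_add_linkMatrix {P R : Finset (Fin n)} {q a : Fin n} (hq : q ∉ P)
    (ha : a ∈ P) (haR : a ∉ R) :
    quasiComplete P q R + linkMatrix a q = quasiComplete P q (insert a R) := by
  have haq : a ≠ q := fun h => hq (h ▸ ha)
  ext i j
  rw [Matrix.add_apply, linkMatrix_apply haq, quasiComplete_apply, quasiComplete_apply]
  split_ifs <;> grind

/-- Quasi-complete graphs with `t` links and a complete subgraph on at least two nodes. -/
def HasQuasiCompleteForm (t : ℕ) (G : Matrix (Fin n) (Fin n) ℝ) : Prop :=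
  ∃ (P : Finset (Fin n)) (q : Fin n) (R : Finset (Fin n)), R ⊂ P ∧ (R.Nonempty → q ∉ P) ∧
    2 ≤ P.card ∧ t = P.card.choose 2 + R.card ∧ G = quasiComplete P q R

/-- When `R` fills up `P`, the node `q` is absorbed into the complete part and `R` restarts empty,
keeping `R` a proper subset. -/
theorem hasQuasiCompleteForm_insert {P R : Finset (Fin n)} {q a : Fin n} (hR : R ⊂ P)
    (hq : q ∉ P) (hP : 2 ≤ P.card) (ha : a ∈ P) (haR : a ∉ R) :
    HasQuasiCompleteForm (P.card.choose 2 + R.card + 1)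
      (quasiComplete P q R + linkMatrix a q) := by
  rw [quasiComplete_add_linkMatrix hq ha haR]
  have hsub : insert a R ⊆ P := Finset.insert_subset ha hR.subset
  by_cases h : insert a R = P
  · refine ⟨insert q P, q, ∅, ?_, by simp, ?_, ?_, ?_⟩
    · exact Finset.empty_ssubset.2 (Finset.insert_nonempty _ _)
    · rw [Finset.card_insert_of_notMem hq]; omega
    · have h1 := Finset.card_insert_of_notMem haR
      rw [h] at h1
      simp only [Finset.card_insert_of_notMem hq, Nat.choose_succ_succ P.card 1,
        Nat.choose_one_right,
        Finset.card_empty, Nat.succ_eq_add_one, Nat.reduceAdd]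
      omega
    · rw [h, quasiComplete_self]
  · exact ⟨P, q, insert a R, hsub.ssubset_of_ne h, fun _ => hq, hP,
      by rw [Finset.card_insert_of_notMem haR]; ring, rfl⟩

/-- A successor of a quasi-complete graph with maximal aggregate centrality is quasi-complete. -/
theorem HasQuasiCompleteForm.add_linkMatrix {t : ℕ} (hG : HasQuasiCompleteForm t G)
    (hadm : ∀ H ∈ linkSucc G, IsAdmissible φ H) {a c : Fin n} (hac : a ≠ c) (h0 : G a c = 0)
    (hmax : ∀ H ∈ linkSucc G, aggregateKB φ H ≤ aggregateKB φ (G + linkMatrix a c)) :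
    HasQuasiCompleteForm (t + 1) (G + linkMatrix a c) := by
  obtain ⟨P, q, R, hR, hq, hP, rfl, rfl⟩ := hG
  set G := quasiComplete P q R with hGdef
  have hnet : G ∈ networks n := quasiComplete_mem_networks P q R
  have hnn : ∀ i j, 0 ≤ G i j := fun i j => (hnet.2.1 i j).1
  have hsucc : ∀ i j, i ≠ j → G i j = 0 → G + linkMatrix i j ∈ linkSucc G :=
    fun i j hij h => ⟨i, j, hij, h, rfl⟩
  obtain ⟨k, hkP, hkR⟩ := Finset.exists_of_ssubset hR
  -- A link leaving `P` must go to `q` if `R` is nonempty. Otherwise its far end is isolated, and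
  -- linking `q` to `k` (if `a ∈ R`) or to `a` (if not) is better.
  have inner : ∀ a c, a ≠ c → G a c = 0 → a ∈ P →
      (∀ H ∈ linkSucc G, aggregateKB φ H ≤ aggregateKB φ (G + linkMatrix a c)) →
      HasQuasiCompleteForm (P.card.choose 2 + R.card + 1) (G + linkMatrix a c) := by
    intro a c hac h0 ha hmax
    have hc : c ∉ P := fun hc => by
      rw [hGdef, quasiComplete_apply, if_pos ⟨hac, Or.inl ⟨ha, hc⟩⟩] at h0
      norm_num at h0
    rcases R.eq_empty_or_nonempty with rfl | hRn
    · rw [hGdef, quasiComplete_empty P q c]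
      exact hasQuasiCompleteForm_insert hR hc hP ha (Finset.notMem_empty a)
    have hqP := hq hRn
    obtain ⟨j, hj⟩ := hRn
    have hcR : c ∉ R := fun h => hc (hR.subset h)
    by_cases hcq : c = q
    · subst hcq
      refine hasQuasiCompleteForm_insert hR hc hP ha fun haR => ?_
      rw [hGdef, quasiComplete_apply, if_pos ⟨hac, Or.inr (Or.inl ⟨haR, rfl⟩)⟩] at h0
      norm_num at h0
    exfalso
    have hiso : ∀ l, G c l = 0 := fun l => by
      rw [hGdef, quasiComplete_apply, if_neg]
      tauto
    rw [linkMatrix_comm] at hmax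
    have hadm' : IsAdmissible φ (G + linkMatrix c a) := hadm _ (hsucc _ _ hac.symm (hiso a))
    have hqR : q ∉ R := fun h => hqP (hR.subset h)
    have hqne : ∀ l ∈ P, q ≠ l := fun l hl h => hqP (h ▸ hl)
    have hq0 : ∀ l ∈ P, l ∉ R → G q l = 0 := fun l hl hlR => by
      rw [hGdef, quasiComplete_apply, if_neg]
      tauto
    have hq1 : ∀ l ∈ R, G q l = 1 := fun l hl => by
      rw [hGdef, quasiComplete_apply, if_pos ⟨hqne l (hR.subset hl), Or.inr (Or.inr ⟨rfl, hl⟩)⟩]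
    by_cases haR : a ∈ R
    · have hs := hsucc q k (hqne k hkP) (hq0 k hkP hkR)
      have hak : a ≠ k := fun h => hkR (h ▸ haR)
      refine (hmax _ hs).not_gt (aggregateKB_complete_lt hnet hac.symm (fun h => hc (h ▸ hkP)) hcq
        hak (hqne a ha).symm (hqne k hkP).symm hiso ?_ ?_ ?_ ?_ (hadm _ hs) hadm')
      · rw [hGdef, quasiComplete_apply, if_pos ⟨hak, Or.inl ⟨ha, hkP⟩⟩]
      · rw [hnet.1, hq1 a haR]
      · rw [hnet.1, hq0 k hkP hkR]
      · intro l hla hlk hlq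
        rw [hGdef, quasiComplete_apply, quasiComplete_apply]
        congr 1
        have := hqne a ha
        have := hqne k hkP
        grind
    · have hs := hsucc q a (hqne a ha) (hq0 a ha haR)
      exact (hmax _ hs).not_gt (aggregateKB_replace_isolated_lt hnn hac.symm hcq hiso (hq1 j hj)
        (fun h => haR (h ▸ hj)) (hadm _ hs) hadm')
  -- A link avoiding `P` has an isolated end `a`; linking its other end to `k ∈ P` is better.
  have outer : ∀ a c, a ≠ c → a ∉ P → c ∉ P → (R.Nonempty → a ≠ q) →
      ¬ ∀ H ∈ linkSucc G, aggregateKB φ H ≤ aggregateKB φ (G + linkMatrix a c) := by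
    intro a c hac ha hc haq hmax
    have hiso : ∀ l, G a l = 0 := fun l => by
      rw [hGdef, quasiComplete_apply, if_neg]
      have : a ∉ R := fun h => ha (hR.subset h)
      have : a = q → l ∉ R := fun h hl => haq ⟨l, hl⟩ h
      tauto
    obtain ⟨j, hj, hjk⟩ := Finset.exists_mem_ne hP k
    have hck : c ≠ k := fun h => hc (h ▸ hkP)
    have hs := hsucc c k hck (by
      rw [hGdef, quasiComplete_apply, if_neg]
      have : c ∉ R := fun h => hc (hR.subset h)
      tauto)
    exact (hmax _ hs).not_gt (aggregateKB_pendant_lt hnn hac (fun h => ha (h ▸ hkP)) hiso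
      (by rw [hGdef, quasiComplete_apply, if_pos ⟨hjk.symm, Or.inl ⟨hkP, hj⟩⟩])
      (hadm _ hs) (hadm _ (hsucc a c hac (hiso c))))
  by_cases ha : a ∈ P
  · exact inner a c hac h0 ha hmax
  by_cases hc : c ∈ P
  · rw [linkMatrix_comm] at hmax ⊢
    exact inner c a hac.symm (by rw [hnet.1, h0]) hc hmax
  -- At most one end can be `q`, so the other one is isolated.
  by_cases haq : R.Nonempty → a ≠ q
  · exact absurd hmax (outer a c hac ha hc haq)
  · rw [linkMatrix_comm] at hmax
    refine absurd hmax (outer c a hac.symm hc ha fun _ hcq => ?_)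
    push Not at haq
    exact hac (haq.2.trans hcq.symm)

theorem hasQuasiCompleteForm_one {a c : Fin n} (hac : a ≠ c) :
    HasQuasiCompleteForm 1 (0 + linkMatrix a c) := by
  refine ⟨{a, c}, a, ∅, Finset.empty_ssubset.2 (by simp), by simp, by rw [Finset.card_pair hac],
    by rw [Finset.card_pair hac]; simp, ?_⟩
  ext i j
  rw [zero_add, linkMatrix_apply hac, quasiComplete_apply]
  congr 1
  grind

theorem HasQuasiCompleteForm.isQuasiComplete {t : ℕ} (hG : HasQuasiCompleteForm t G)
    (hN : IsNSG G) (hlinks : numLinks G = t) : IsQuasiComplete t G := by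
  refine ⟨hN, hlinks, ?_⟩
  obtain ⟨P, q, R, hR, hq, hP, rfl, rfl⟩ := hG
  have hcard := Finset.card_lt_card hR
  have h1 : ∀ i j, quasiComplete P q R i j = 1 → (i ∈ P ∧ j ∈ P) ∨ (i ∈ R ∧ j = q) ∨
      (i = q ∧ j ∈ R) := by
    intro i j h
    rw [quasiComplete_apply] at h
    split_ifs at h with h'
    · exact h'.2
    · norm_num at h
  refine ⟨P, ?_, ?_, fun i hi j hj hij => ?_, ?_⟩
  · rw [Nat.choose_two_right]; omega
  · have := Nat.triangle_succ P.card
    rw [Nat.add_sub_cancel] at this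
    rw [mul_comm, this, Nat.choose_two_right]
    omega
  · rw [quasiComplete_apply, if_pos ⟨hij, Or.inl ⟨hi, hj⟩⟩]
  · rcases R.eq_empty_or_nonempty with rfl | hRn
    · exact Or.inl fun i j h => by simpa using h1 i j h
    · refine Or.inr ⟨q, hq hRn, fun i j h => ?_⟩
      rcases h1 i j h with h | h | h
      · exact Or.inl h
      · exact Or.inr (Or.inl ⟨hR.subset h.1, h.2⟩)
      · exact Or.inr (Or.inr ⟨h.1, hR.subset h.2⟩)

theorem numLinks_eq {t : ℕ} (hG : IsUnweighted G) (htot : ∑ i, ∑ j, G i j = 2 * t) :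
    numLinks G = t := by
  rw [total_eq_two_mul hG.1.1 hG.1.2.2] at htot
  have h1 : ∑ e : Link n, G e.1.1 e.1.2 = t := by linarith
  have h2 : ∀ e : Link n, G e.1.1 e.1.2 = if G e.1.1 e.1.2 = 1 then 1 else 0 := fun e => by
    rcases hG.2 e.1.1 e.1.2 with h | h <;> simp [h]
  rw [Finset.sum_congr rfl fun e _ => h2 e, Finset.sum_boole] at h1
  have h3 : {e : Fin n × Fin n | e.1 < e.2 ∧ G e.1 e.2 = 1} =
      Subtype.val '' {e : Link n | G e.1.1 e.1.2 = 1} := by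
    ext e; simp [and_comm]
  rw [numLinks, h3, Set.ncard_image_of_injective _ Subtype.val_injective,
    Set.ncard_eq_toFinset_card']
  have h4 : (Set.toFinset {e : Link n | G e.1.1 e.1.2 = 1}) =
      Finset.univ.filter fun e : Link n => G e.1.1 e.1.2 = 1 := by
    ext e; simp
  rw [h4]
  exact_mod_cast h1

/-- The induction starts at one link, where every network has the form and no optimality is needed.
It passes through periods with `D = 0` as well, since myopia makes every step greedy. -/
theorem hasQuasiCompleteForm_of_isSolution
    (hadm : ∀ s ∈ weightedPaths n T, ∀ t ≤ T, IsAdmissible φ (s t)) (hmy : IsMyopic n φ T D)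
    (hs : IsSolution φ T D s) (hsl : s ∈ linkPaths n T) {t : ℕ} (ht : t < T) :
    HasQuasiCompleteForm (t + 1) (s (t + 1)) := by
  induction t with
  | zero =>
    obtain ⟨a, c, hac, -, h⟩ := hsl.2 0 ht
    rw [h, hsl.1]
    exact hasQuasiCompleteForm_one hac
  | succ t ih =>
    obtain ⟨a, c, hac, h0, h⟩ := hsl.2 (t + 1) ht
    have hmax := fun H (hH : H ∈ linkSucc (s (t + 1))) =>
      aggregateKB_le_of_mem_linkSucc hmy hs hsl ht hH
    rw [h] at hmax ⊢
    refine (ih (Nat.lt_of_succ_lt ht)).add_linkMatrix (fun H hH => ?_) hac h0 hmax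
    obtain ⟨q, hq, -, rfl⟩ := exists_linkPaths_of_mem_linkSucc hsl ht hH
    exact hadm q (linkPaths_subset_weightedPaths hq) _ ht

end NetworkDesign

theorem proposition1 (n T : ℕ) (φ : ℝ) (hφ : 0 < φ)
    (hspec : ∀ s ∈ NetworkDesign.weightedPaths n T, ∀ t ∈ Finset.Icc 1 T,
      ENNReal.ofReal φ < 1 / spectralRadius ℝ (s t))
    (D : ℕ → ℝ) (hD : ∀ t ∈ Finset.Icc 1 T, 0 ≤ D t ∧ D t ≤ 1)
    (s : ℕ → Matrix (Fin n) (Fin n) ℝ) (hs : NetworkDesign.IsSolution φ T D s) :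
    (∀ t ∈ Finset.Icc 1 T, 0 < D t → NetworkDesign.IsNSG (s t)) ∧
    (NetworkDesign.IsMyopic n φ T D →
      ∀ t ∈ Finset.Icc 1 T, 0 < D t → NetworkDesign.IsQuasiComplete t (s t)) := by
  open NetworkDesign in
  have hadm : ∀ s ∈ weightedPaths n T, ∀ t ≤ T, IsAdmissible φ (s t) := by
    intro s hs t ht
    rcases Nat.eq_zero_or_pos t with rfl | h0
    · rw [hs.1]
      exact isAdmissible_zero hφ
    · exact isAdmissible_of_spectralRadius hφ (networks_of_mem_weightedPaths hs ht)
        (hspec s hs t (Finset.mem_Icc.2 ⟨h0, ht⟩))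
  obtain ⟨p, hp, hpsol, hsp⟩ :=
    NetworkDesign.exists_linkPaths_solution (fun t ht => (hD t ht).1) hadm hs
  refine ⟨fun t ht hDt => (hsp t ht hDt).1 ▸ (hsp t ht hDt).2, fun hmy t ht hDt => ?_⟩
  obtain ⟨h1, h2⟩ := hsp t ht hDt
  rw [h1]
  obtain ⟨h0, htT⟩ := Finset.mem_Icc.1 ht
  obtain ⟨r, rfl⟩ := Nat.exists_eq_add_of_le' h0
  exact (NetworkDesign.hasQuasiCompleteForm_of_isSolution hadm hmy hpsol hp htT).isQuasiComplete h2
    (NetworkDesign.numLinks_eq h2.1 (NetworkDesign.total_of_mem_weightedPaths hpsol.1 htT))
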